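/- **Setting.** Let $E$ be a finite-dimensional Euclidean space with norm $\|\cdot\|$ (the norm of its inner product), $E^*$ its dual with dual norm $\|\cdot\|_*$, $Q\subset E$ closed and convex, $f,h$ convex on $Q$, $\varphi=f+h$ (measurable), and let $x^*$ be a minimizer of $\varphi$ on $Q$, $\varphi^*=\varphi(x^*)$. Let $\varphi$ be $\mu$-strongly convex on $Q$, $\mu>0$: $\frac\mu2\|x-y\|^2\le\varphi(y)-\varphi(x)-\langle g,y-x\rangle$ for all $x,y\in Q$, $g\in\partial\varphi(x)$. Let $f$ have a stochastic inexact oracle with bias $\delta$, constant $L>0$ and noise level $\sigma\ge0$: for $x\in Q$ there are $f_\delta(x)\in\mathbb R$, $g_\delta(x)\in E^*$ with $0\le f(y)-f_\delta(x)-\langle g_\delta(x),y-x\rangle\le\frac L2\|x-y\|^2+\delta$ for all $y\in Q$, and a random variable $\xi$, whose law may depend on $x$, with $\mathbb E F(x,\xi)=f_\delta(x)$, $\mathbb E G(x,\xi)=g_\delta(x)$, $\mathbb E\|G(x,\xi)-g_\delta(x)\|_*^2\le\sigma^2$. Let $d:E\to\mathbb R$ be differentiable and $1$-strongly convex with $d(0)=0=\min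 d$, and let $V>0$ be such that $\mathbb E\,d((x-X)/R)\le V^2/2$ whenever $R>0$, $x\in E$ and $X$ is a random vector with $\mathbb E\|x-X\|^2\le R^2$. **Constants.** Let $p\in[1,2]$, $C_1=4\sqrt2$, $C_2=16\sqrt2$, $C_3=48$, $\kappa=4eC_1LV^2/\mu$, and let $\|u_0-x^*\|\le R_0$, $R_0>0$. If $p>1$ and $\delta>0$, assume $\kappa^{1/p}\ge\frac12$. Put $N_k=\lceil\kappa^{1/p}\rceil$ and $$m_k=\max\Bigl\{1,\Bigl\lceil\tfrac{16e^{k+2}C_2^2\sigma^2V^2}{\mu^2R_0^2N_k}\Bigr\rceil\Bigr\},\qquad R_k^2=R_0^2e^{-k}+\tfrac{2^peC_3\delta}{\mu(e-1)}\kappa^{\frac{p-1}p}(1-e^{-k}).$$ **Method (SIGMA).** In the $k$-th outer iteration ($k=0,1,\dots$) let $D(x)=d((x-u_k)/R_k)$, $V_D(x,z)=D(x)-D(z)-\langle\nabla D(z),x-z\rangle$, $a=2^{\frac{2p-1}2}$, $b=2^{\frac{5-2p}4}p^{\frac{1-2p}2}$, $\alpha_i=\frac1a(\frac{i+p}p)^{p-1}$,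 $B_i=\frac1a(\frac{i+p}p)^{2p-2}$, $\beta_i=LR_k^2+\frac{b\sigma R_k}{V\sqrt{m_k}}(i+p+1)^{\frac{2p-1}2}$, $A_i=\sum_{l\le i}\alpha_l$, $\tau_i=\alpha_{i+1}/B_{i+1}$. At each query point $x_i$ draw, given the past, $m_k$ i.i.d. samples with the law that the oracle associates with $x_i$, and let $\tilde G_i$ be the average of the $m_k$ answers $G(x_i,\cdot)$. Start from $x_0=u_k$ and $y_0=\arg\min_{x\in Q}\{\beta_0D(x)+\alpha_0\langle\tilde G_0,x-x_0\rangle+\alpha_0h(x)\}$. For $i=0,\dots,N_k-1$ compute $$z_i=\arg\min_{x\in Q}\Bigl\{\beta_iD(x)+\sum_{l\le i}\alpha_l\langle\tilde G_l,x-x_l\rangle+A_ih(x)\Bigr\},\qquad x_{i+1}=\tau_iz_i+(1-\tau_i)y_i,$$ $$\hat x_{i+1}=\arg\min_{x\in Q}\{\beta_iV_D(x,z_i)+\alpha_{i+1}\langle\tilde G_{i+1},x-z_i\rangle+\alpha_{i+1}h(x)\},$$ $$w_{i+1}=\tau_i\hat x_{i+1}+(1-\tau_i)y_i,\qquad y_{i+1}=\tfrac{A_{i+1}-B_{i+1}}{A_{i+1}}y_i+\tfrac{B_{i+1}}{A_{i+1}}w_{i+1},$$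 and set $u_{k+1}=y_{N_k}$. (All these minimizers are assumed to exist.) **Theorem.** After $k\ge1$ outer iterations $$\mathbb E\varphi(u_k)-\varphi^*\le\frac{\mu R_0^2}2e^{-k}+\frac{C_3e2^{p-1}}{e-1}\kappa^{\frac{p-1}p}\delta,\qquad \mathbb E\|u_k-x^*\|^2\le R_0^2e^{-k}+\frac{C_3e2^p}{\mu(e-1)}\kappa^{\frac{p-1}p}\delta,$$ where both expectations are finite. Consequently, if $0<\varepsilon<\mu R_0^2$ and $\delta\le\frac{\varepsilon(e-1)}{2^pC_3e}\kappa^{\frac{1-p}p}$, then after $N=\lceil\ln(\mu R_0^2/\varepsilon)\rceil$ outer iterations $\mathbb E\varphi(u_N)-\varphi^*\le\varepsilon$. The number of oracle calls in the inner iterations, $\sum_{k<N}N_km_k$, is at most $$\bigl(1+\kappa^{1/p}\bigr)\Bigl(1+\ln\frac{\mu R_0^2}\varepsilon\Bigr)+\frac{16e^3C_2^2\sigma^2V^2}{\mu\varepsilon(e-1)},$$ and the number of all oracle calls, $\sum_{k<N}(N_k+1)m_k$, which includes those at the starting points $x_0=u_k$, is at most $$\bigl(2+\kappa^{1/p}\bigr)\Bigl(1+\ln\frac{\mu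 R_0^2}\varepsilon\Bigr)+\frac{32e^3C_2^2\sigma^2V^2}{\mu\varepsilon(e-1)}.$$ -/

import Mathlib

open MeasureTheory ProbabilityTheory

noncomputable section

namespace SIGMA

/-! ### The composite problem, the oracle and the prox-function -/

section Problem

variable {E : Type*} [NormedAddCommGroup E] [InnerProductSpace ℝ E]

/-- `x` is a minimizer of `Φ` on `Q`. -/
def IsArgmin (Φ : E → ℝ) (Q : Set E) (x : E) : Prop :=
  x ∈ Q ∧ IsMinOn Φ Q x

/-- `g` belongs to the subdifferential at `x` of the function `φ` on `Q`. -/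
def IsSubgradient (Q : Set E) (φ : E → ℝ) (x : E) (g : StrongDual ℝ E) : Prop :=
  ∀ y ∈ Q, φ x + g (y - x) ≤ φ y

/-- Strong convexity of `φ` on `Q` with parameter `μ`, in its first-order form:
`(μ / 2) ‖x - y‖² ≤ φ y - φ x - ⟨g, y - x⟩` for all `x, y ∈ Q` and `g ∈ ∂φ(x)`. -/
def IsStronglyConvex (Q : Set E) (μ : ℝ) (φ : E → ℝ) : Prop :=
  ∀ x ∈ Q, ∀ g : StrongDual ℝ E, IsSubgradient Q φ x g →
    ∀ y ∈ Q, μ / 2 * ‖x - y‖ ^ 2 ≤ φ y - φ x - g (y - x)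

/-- `(fδ, gδ)` is a `(δ, L)`-oracle for `f` on `Q`. -/
def IsInexactOracle (Q : Set E) (f : E → ℝ) (δ L : ℝ)
    (fδ : E → ℝ) (gδ : E → StrongDual ℝ E) : Prop :=
  ∀ x ∈ Q, ∀ y ∈ Q,
    0 ≤ f y - fδ x - gδ x (y - x) ∧
    f y - fδ x - gδ x (y - x) ≤ L / 2 * ‖x - y‖ ^ 2 + δ

/-- Stochastic inexact oracle with bias `δ`, constant `L` and noise level `σ` for `f` on `Q`.
The random variable `ξ` that is associated with the point `x` has the law `ν x` (it may depend
on `x`); `(F x ξ, G x ξ)` is an unbiased random approximation of the `(δ, L)`-oracle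
`(fδ x, gδ x)`, and the noise of `G` is measured in the dual norm. -/
structure IsStochasticOracle [MeasurableSpace E] {Ξ : Type*} [MeasurableSpace Ξ]
    (Q : Set E) (f : E → ℝ) (δ L σ : ℝ) (fδ : E → ℝ) (gδ : E → StrongDual ℝ E)
    (ν : Kernel E Ξ) (F : E → Ξ → ℝ) (G : E → Ξ → StrongDual ℝ E) : Prop where
  inexact : IsInexactOracle Q f δ L fδ gδ
  measurable_G : Measurable fun q : Q × Ξ => G q.1 q.2
  integrable_F : ∀ x ∈ Q, Integrable (F x) (ν x)
  mean_F : ∀ x ∈ Q, ∫ s, F x s ∂(ν x) = fδ x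
  integrable_G : ∀ x ∈ Q, Integrable (G x) (ν x)
  mean_G : ∀ x ∈ Q, ∫ s, G x s ∂(ν x) = gδ x
  integrable_noise : ∀ x ∈ Q, Integrable (fun s => ‖G x s - gδ x‖ ^ 2) (ν x)
  noise_le : ∀ x ∈ Q, ∫ s, ‖G x s - gδ x‖ ^ 2 ∂(ν x) ≤ σ ^ 2

/-- Prox-function: differentiable, strongly convex with parameter `1`, with minimizer `0` and
minimal value `0`. It is a function on the whole space, since the restarted method evaluates it
at the points `(x - u) / R` with `x, u ∈ Q` and `R > 0`. -/
structure IsProxFunction (d : E → ℝ) : Prop where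
  differentiable : Differentiable ℝ d
  strongConvex : StrongConvexOn Set.univ 1 d
  map_zero : d 0 = 0
  nonneg : ∀ x, 0 ≤ d x

/-- If `x₀` is a random vector (here given by its law `ρ`) with `𝔼 ‖x - x₀‖² ≤ R²` for a fixed
point `x` and a number `R > 0`, then `𝔼 d ((x - x₀) / R) ≤ V² / 2`. -/
def HasProxMomentBound [MeasurableSpace E] (d : E → ℝ) (V : ℝ) : Prop :=
  ∀ (ρ : Measure E) [IsProbabilityMeasure ρ] (x : E) (R : ℝ), 0 < R →
    Integrable (fun x₀ => ‖x - x₀‖ ^ 2) ρ → ∫ x₀, ‖x - x₀‖ ^ 2 ∂ρ ≤ R ^ 2 →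
    Integrable (fun x₀ => d (R⁻¹ • (x - x₀))) ρ ∧
      ∫ x₀, d (R⁻¹ • (x - x₀)) ∂ρ ≤ V ^ 2 / 2

/-- Bregman distance of `D`. -/
def bregman (D : E → ℝ) (x z : E) : ℝ :=
  D x - D z - fderiv ℝ D z (x - z)

end Problem

/-! ### Constants and coefficient sequences -/

def C₁ : ℝ := 4 * √2

def C₂ : ℝ := 16 * √2

def C₃ : ℝ := 48

/-- `α_i = (1 / a) ((i + p) / p) ^ (p - 1)` with `a = 2 ^ ((2 p - 1) / 2)`. -/
def alphaSeq (p : ℝ) (i : ℕ) : ℝ :=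
  1 / (2 : ℝ) ^ ((2 * p - 1) / 2) * ((i + p) / p) ^ (p - 1)

/-- `B_i = (1 / a) ((i + p) / p) ^ (2 p - 2)` with `a = 2 ^ ((2 p - 1) / 2)`. -/
def bSeq (p : ℝ) (i : ℕ) : ℝ :=
  1 / (2 : ℝ) ^ ((2 * p - 1) / 2) * ((i + p) / p) ^ (2 * p - 2)

/-- `β_i = L + (b σ / R) (i + p + 1) ^ ((2 p - 1) / 2)` with
`b = 2 ^ ((5 - 2 p) / 4) p ^ ((1 - 2 p) / 2)`. -/
def betaSeq (p L σ R : ℝ) (i : ℕ) : ℝ :=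
  L + (2 : ℝ) ^ ((5 - 2 * p) / 4) * p ^ ((1 - 2 * p) / 2) * σ / R
    * (i + p + 1) ^ ((2 * p - 1) / 2)

/-- The numbers that enter the restarted method: the exponent `p`, the oracle constants `L`,
`σ`, `δ`, the strong convexity parameter `μ`, the constant `V` of the prox-function and the
bound `R₀` on the initial distance to the solution. -/
structure Params where
  p : ℝ
  L : ℝ
  σ : ℝ
  δ : ℝ
  μ : ℝ
  V : ℝ
  R₀ : ℝ

namespace Params

/-- `4 e C₁ L V² / μ`. -/
def kappa (π : Params) : ℝ := 4 * Real.exp 1 * C₁ * π.L * π.V ^ 2 / π.μ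

/-- The number `N_k` of inner iterations; it does not depend on `k`. -/
def innerSteps (π : Params) : ℕ := ⌈π.kappa ^ (1 / π.p)⌉₊

/-- The mini-batch size `m_k`. -/
def batchSize (π : Params) (k : ℕ) : ℕ :=
  max 1 ⌈16 * Real.exp (k + 2) * C₂ ^ 2 * π.σ ^ 2 * π.V ^ 2
    / (π.μ ^ 2 * π.R₀ ^ 2 * π.innerSteps)⌉₊

/-- The squared radius `R_k²`. -/
def radiusSq (π : Params) (k : ℕ) : ℝ :=
  π.R₀ ^ 2 * Real.exp (-k)
    + (2 : ℝ) ^ π.p * Real.exp 1 * C₃ * π.δ / (π.μ * (Real.exp 1 - 1))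
      * π.kappa ^ ((π.p - 1) / π.p) * (1 - Real.exp (-k))

/-- The radius `R_k`. -/
def radius (π : Params) (k : ℕ) : ℝ := √(π.radiusSq k)

/-- The sequence `β` of the `k`-th outer iteration. With respect to the norm `‖·‖ / R_k` the
constant of the oracle is `L R_k²`, the noise level of a mini-batch of size `m_k` is
`σ R_k / √m_k`, and the radius in terms of the prox-function is `V`. -/
def beta (π : Params) (k : ℕ) : ℕ → ℝ :=
  betaSeq π.p (π.L * π.radius k ^ 2) (π.σ * π.radius k / √(π.batchSize k)) π.V

/-- The oracle calls of the first `K` outer iterations: in each of them a mini-batch of size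
`m_k` is drawn at each of the points `x_0, …, x_{N_k}`. -/
def totalCalls (π : Params) (K : ℕ) : ℕ :=
  ∑ k ∈ Finset.range K, ∑ _i ∈ Finset.Icc 0 π.innerSteps, π.batchSize k

/-- The oracle calls that are made within the inner iterations `1, …, N_k` of the first `K` outer
iterations, that is, all calls but those at the starting points `x_0 = u_k`. -/
def innerCalls (π : Params) (K : ℕ) : ℕ :=
  ∑ k ∈ Finset.range K, ∑ _i ∈ Finset.Icc 1 π.innerSteps, π.batchSize k

end Params

/-! ### The methods -/

section Methods

variable {E : Type*} [NormedAddCommGroup E] [InnerProductSpace ℝ E]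

/-- `n` steps of the stochastic intermediate gradient method with prox-function `D` and
coefficients `α`, `β`, `B`, where `γ i` is the answer of the gradient oracle at the point `x i`.
The output is `y n`. -/
structure IsSIGMRun (Q : Set E) (h : E → ℝ) (α β B : ℕ → ℝ) (D : E → ℝ) (n : ℕ)
    (γ : ℕ → StrongDual ℝ E) (x y z xhat w : ℕ → E) : Prop where
  x_zero : IsArgmin D Q (x 0)
  y_zero : IsArgmin (fun v => β 0 * D v + α 0 * γ 0 (v - x 0) + α 0 * h v) Q (y 0)
  z_argmin : ∀ i < n, IsArgmin
    (fun v => β i * D v + ∑ l ∈ Finset.range (i + 1), α l * γ l (v - x l)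
      + (∑ l ∈ Finset.range (i + 1), α l) * h v) Q (z i)
  x_succ : ∀ i < n,
    x (i + 1) = (α (i + 1) / B (i + 1)) • z i + (1 - α (i + 1) / B (i + 1)) • y i
  xhat_argmin : ∀ i < n, IsArgmin
    (fun v => β i * bregman D v (z i) + α (i + 1) * γ (i + 1) (v - z i)
      + α (i + 1) * h v) Q (xhat (i + 1))
  w_succ : ∀ i < n,
    w (i + 1) = (α (i + 1) / B (i + 1)) • xhat (i + 1) + (1 - α (i + 1) / B (i + 1)) • y i
  y_succ : ∀ i < n,
    y (i + 1) =
      ((∑ l ∈ Finset.range (i + 2), α l - B (i + 1)) / ∑ l ∈ Finset.range (i + 2), α l) • y i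
        + (B (i + 1) / ∑ l ∈ Finset.range (i + 2), α l) • w (i + 1)

/-- The σ-algebra of all samples that are drawn before the `i`-th query of the `k`-th outer
iteration; `ξ k i j` is the `j`-th sample of the mini-batch of that query. -/
@[reducible] def history {Ω Ξ : Type*} [MeasurableSpace Ξ] (π : Params) (ξ : ℕ → ℕ → ℕ → Ω → Ξ) (k i : ℕ) :
    MeasurableSpace Ω :=
  ⨆ (k' : ℕ) (i' : ℕ) (j : ℕ)
    (_ : (k' < k ∧ i' ≤ π.innerSteps ∨ k' = k ∧ i' < i) ∧ j < π.batchSize k'),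
    MeasurableSpace.comap (ξ k' i' j) inferInstance

/-- `K` outer iterations of the restarted method on the probability space `(Ω, P)`, started at
`u₀`. The letters `x y z xhat w` denote the inner iterates, indexed by the outer and the inner
iteration. -/
structure IsSIGMARun [MeasurableSpace E] {Ω Ξ : Type*} [MeasurableSpace Ω] [MeasurableSpace Ξ]
    (Q : Set E) (h d : E → ℝ) (π : Params) (ν : Kernel E Ξ) (G : E → Ξ → StrongDual ℝ E)
    (u₀ : E) (K : ℕ) (P : Measure Ω) (ξ : ℕ → ℕ → ℕ → Ω → Ξ)
    (u : ℕ → Ω → E) (x y z xhat w : ℕ → ℕ → Ω → E) : Prop where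
  measurable_sample : ∀ k i j, Measurable (ξ k i j)
  /-- Given the past, the samples of the mini-batch at the query point `x k i` are independent
  and identically distributed with the law that the oracle associates with this point. -/
  sample_law : ∀ k < K, ∀ i ≤ π.innerSteps, ∀ A : Set Ω, MeasurableSet[history π ξ k i] A →
    ∀ S : ℕ → Set Ξ, (∀ j, MeasurableSet (S j)) →
      P (A ∩ ⋂ j ∈ Finset.range (π.batchSize k), ξ k i j ⁻¹' S j) =
        ∫⁻ ω in A, ∏ j ∈ Finset.range (π.batchSize k), ν (x k i ω) (S j) ∂P
  u_zero : ∀ ω, u 0 ω = u₀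
  start : ∀ k < K, ∀ ω, x k 0 ω = u k ω
  inner : ∀ k < K, ∀ ω, IsSIGMRun Q h (alphaSeq π.p) (π.beta k) (bSeq π.p)
    (fun v => d ((π.radius k)⁻¹ • (v - u k ω))) π.innerSteps
    (fun i => (π.batchSize k : ℝ)⁻¹ •
      ∑ j ∈ Finset.range (π.batchSize k), G (x k i ω) (ξ k i j ω))
    (fun i => x k i ω) (fun i => y k i ω) (fun i => z k i ω)
    (fun i => xhat k i ω) (fun i => w k i ω)
  u_succ : ∀ k < K, ∀ ω, u (k + 1) ω = y k π.innerSteps ω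

end Methods

end SIGMA

end

/-! The proof is a restart argument. Measured in the norm `‖·‖ / R_k`, an outer iteration is a run
of an accelerated stochastic method that turns `𝔼‖u_k - x*‖² ≤ R_k²` into `𝔼 φ(u_{k+1}) - φ* ≤ (μ/2)
R_{k+1}²`. Since `0` is a subgradient of `φ` at `x*`, strong convexity then gives `𝔼‖u_{k+1} - x*‖²
≤ R_{k+1}²`, and `IsSIGMARun.invariant` closes the induction.

The inner bound is pathwise at first (`IsSIGMRun.estimate`, `IsSIGMRun.gap_le`): `A_i φ(y_i)` is at
most the model minimized by `z_i`, evaluated at any point of `Q`, plus an accumulated error. The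
Bregman term of weight `β_i` pays for the quadratic oracle error and, by Young's inequality, for
part of the noise. What remains is `‖ε_l‖² / (2 (β_{l-1} / R² - L))` and the linear terms `⟨ε_l, x*
- z_{l-1}⟩`. As `z_{l-1}` depends only on samples drawn before query `l`, the linear terms have mean
zero, and independence inside a mini-batch leaves the variance `σ² / m_k`
(`IsNoiseField.batch_mean`). `expected_gap_le` takes expectations. Two points need care: the
iterates must be measurable with respect to the past, which follows from the stability of strongly
convex minimization (`measurable_argmin`), and `z_{l-1}` must be square integrable, which the
pathwise estimate itself provides.

After division by `A_n`, of order at least `n^p`, the error is `C₁ L R² V² / n^p`, a noise term of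
order `1 / √n`, and a multiple of `δ` (`error_le`, `sum_bSeq_le`). The choices of `N_k` and `m_k`
make each of the first two at most `μ R_k² / (4e)`, which fits the affine recursion solved by `R_k²`
(`inner_error_le`). The mini-batches grow like `e^k`, so the number of calls is a geometric sum. -/

noncomputable section

namespace SIGMA

open Filter Topology
open scoped RealInnerProductSpace

/-! ### Pathwise analysis of the intermediate gradient method -/

section Deterministic

variable {E : Type*} [NormedAddCommGroup E] [InnerProductSpace ℝ E]

theorem tendsto_slope_fderiv {D : E → ℝ} {z : E} (hD : DifferentiableAt ℝ D z) (w : E) :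
    Tendsto (fun t : ℝ => t⁻¹ * (D (z + t • w) - D z)) (𝓝[>] 0) (𝓝 (fderiv ℝ D z w)) := by
  have h := (hD.hasFDerivAt.hasLineDerivAt w).tendsto_slope_zero_right
  simpa using h

/-- A minimizer over a convex set of a differentiable function plus a convex function satisfies
the three-point inequality. -/
theorem IsArgmin.add_bregman_le {Q : Set E} {D ψ : E → ℝ} {β : ℝ} {z v : E}
    (hψ : ConvexOn ℝ Q ψ) (hD : DifferentiableAt ℝ D z)
    (hz : IsArgmin (fun v => β * D v + ψ v) Q z) (hv : v ∈ Q) :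
    β * D z + ψ z + β * bregman D v z ≤ β * D v + ψ v := by
  -- First-order optimality along the segment from `z` to `v`: the convex part is bounded by its
  -- chord, so only `D` has to be differentiated.
  have hlim : Tendsto (fun t : ℝ => β * (t⁻¹ * (D (z + t • (v - z)) - D z)) + (ψ v - ψ z))
      (𝓝[>] 0) (𝓝 (β * fderiv ℝ D z (v - z) + (ψ v - ψ z))) :=
    ((tendsto_slope_fderiv hD (v - z)).const_mul β).add_const _
  have hev : ∀ᶠ t : ℝ in 𝓝[>] 0,
      0 ≤ β * (t⁻¹ * (D (z + t • (v - z)) - D z)) + (ψ v - ψ z) := by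
    filter_upwards [Ioo_mem_nhdsGT (show (0 : ℝ) < 1 by norm_num)] with t ht
    have hcomb : (1 - t) • z + t • v = z + t • (v - z) := by module
    have hmem : z + t • (v - z) ∈ Q := by
      rw [← hcomb]
      exact hψ.1 hz.1 hv (by linarith [ht.2]) ht.1.le (by ring)
    have h1 : β * D z + ψ z ≤ β * D (z + t • (v - z)) + ψ (z + t • (v - z)) := hz.2 hmem
    have h2 := hψ.2 hz.1 hv (show (0 : ℝ) ≤ 1 - t by linarith [ht.2]) ht.1.le (by ring)
    rw [hcomb, smul_eq_mul, smul_eq_mul] at h2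
    have h3 : 0 ≤ t⁻¹ * (β * (D (z + t • (v - z)) - D z) + t * (ψ v - ψ z)) :=
      mul_nonneg (inv_nonneg.2 ht.1.le) (by linarith)
    have h4 : t⁻¹ * (β * (D (z + t • (v - z)) - D z) + t * (ψ v - ψ z))
        = β * (t⁻¹ * (D (z + t • (v - z)) - D z)) + (ψ v - ψ z) := by
      have := ht.1.ne'
      field_simp
    rwa [h4] at h3
  have := ge_of_tendsto hlim hev
  rw [bregman]
  linarith

/-- Apply strong convexity on the segment from `z` to `x`, divide by its parameter `t` and let `t`
tend to `0` from the right. -/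
theorem IsProxFunction.le_bregman {d : E → ℝ} (hd : IsProxFunction d) (x z : E) :
    1 / 2 * ‖x - z‖ ^ 2 ≤ bregman d x z := by
  have hlim := tendsto_slope_fderiv (hd.differentiable z) (x - z)
  have hlim2 : Tendsto (fun t : ℝ => d x - d z - (1 - t) * (1 / 2 * ‖x - z‖ ^ 2)) (𝓝[>] 0)
      (𝓝 (d x - d z - (1 - 0) * (1 / 2 * ‖x - z‖ ^ 2))) :=
    tendsto_nhdsWithin_of_tendsto_nhds (Continuous.tendsto (by fun_prop) 0)
  have hev : ∀ᶠ t : ℝ in 𝓝[>] 0, t⁻¹ * (d (z + t • (x - z)) - d z)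
      ≤ d x - d z - (1 - t) * (1 / 2 * ‖x - z‖ ^ 2) := by
    filter_upwards [Ioo_mem_nhdsGT (show (0 : ℝ) < 1 by norm_num)] with t ht
    have hcomb : (1 - t) • z + t • x = z + t • (x - z) := by module
    have h2 := hd.strongConvex.2 (Set.mem_univ z) (Set.mem_univ x)
      (show (0 : ℝ) ≤ 1 - t by linarith [ht.2]) ht.1.le (by ring)
    rw [hcomb, norm_sub_rev z x] at h2
    simp only [smul_eq_mul] at h2
    rw [inv_mul_le_iff₀ ht.1]
    linarith
  have := le_of_tendsto_of_tendsto hlim hlim2 hev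
  rw [bregman]
  linarith

/-- The prox-function centred at `u` in the norm `‖·‖ / R`. -/
theorem differentiable_rescaled {d : E → ℝ} (hd : Differentiable ℝ d) (u : E) (R : ℝ) :
    Differentiable ℝ fun v => d (R⁻¹ • (v - u)) := by
  fun_prop

theorem fderiv_rescaled {d : E → ℝ} (hd : Differentiable ℝ d) (u z : E) (R : ℝ) :
    fderiv ℝ (fun v => d (R⁻¹ • (v - u))) z = R⁻¹ • fderiv ℝ d (R⁻¹ • (z - u)) := by
  have h1 : HasFDerivAt (fun v : E => R⁻¹ • (v - u)) (R⁻¹ • ContinuousLinearMap.id ℝ E) z :=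
    ((hasFDerivAt_id z).sub_const u).const_smul R⁻¹
  have h2 : HasFDerivAt (fun v => d (R⁻¹ • (v - u)))
      ((fderiv ℝ d (R⁻¹ • (z - u))).comp (R⁻¹ • ContinuousLinearMap.id ℝ E)) z :=
    (hd _).hasFDerivAt.comp z h1
  rw [h2.fderiv]
  ext v
  simp

theorem bregman_rescaled {d : E → ℝ} (hd : Differentiable ℝ d) (u : E) (R : ℝ) (x z : E) :
    bregman (fun v => d (R⁻¹ • (v - u))) x z
      = bregman d (R⁻¹ • (x - u)) (R⁻¹ • (z - u)) := by
  have h : R⁻¹ • (x - u) - R⁻¹ • (z - u) = R⁻¹ • (x - z) := by module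
  simp [bregman, fderiv_rescaled hd, h]

theorem IsProxFunction.le_bregman_rescaled {d : E → ℝ} (hd : IsProxFunction d) (u : E) (R : ℝ)
    (x z : E) :
    (R ^ 2)⁻¹ / 2 * ‖x - z‖ ^ 2 ≤ bregman (fun v => d (R⁻¹ • (v - u))) x z := by
  rw [bregman_rescaled hd.differentiable]
  refine le_trans (le_of_eq ?_) (hd.le_bregman _ _)
  have h : R⁻¹ • (x - u) - R⁻¹ • (z - u) = R⁻¹ • (x - z) := by module
  rw [h, norm_smul, mul_pow, Real.norm_eq_abs, sq_abs]
  ring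

theorem convexOn_affine_add {Q : Set E} {h : E → ℝ} (hh : ConvexOn ℝ Q h) {A : ℝ} (hA : 0 ≤ A)
    (S : StrongDual ℝ E) (c : ℝ) : ConvexOn ℝ Q fun v => S v + c + A * h v := by
  have h1 : ConvexOn ℝ Q fun v => S v + c :=
    (S.toLinearMap.convexOn hh.1).add (convexOn_const c hh.1)
  exact h1.add (hh.smul hA)

theorem sum_smul_apply_sub (γ : ℕ → StrongDual ℝ E) (α : ℕ → ℝ) (x : ℕ → E) (s : Finset ℕ)
    (v : E) : ∑ l ∈ s, α l * γ l (v - x l)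
      = (∑ l ∈ s, α l • γ l) v + -∑ l ∈ s, α l * γ l (x l) := by
  simp [mul_add, Finset.sum_add_distrib, sub_eq_add_neg]

/-- Young's inequality, in the degenerate case `c = 0` for the zero functional. -/
theorem neg_apply_le_young (ε : StrongDual ℝ E) (v : E) {c : ℝ} (hc : 0 ≤ c)
    (hε : c = 0 → ε = 0) : -ε v ≤ ‖ε‖ ^ 2 / (2 * c) + c / 2 * ‖v‖ ^ 2 := by
  rcases hc.eq_or_lt with hc | hc
  · simp [hε hc.symm, ← hc]
  · have h1 : -ε v ≤ ‖ε‖ * ‖v‖ := (neg_le_abs _).trans (ε.le_opNorm v)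
    have h2 : ‖ε‖ ^ 2 / (2 * c) + c / 2 * ‖v‖ ^ 2 - ‖ε‖ * ‖v‖
        = (‖ε‖ - c * ‖v‖) ^ 2 / (2 * c) := by
      field_simp
      ring
    have h3 : 0 ≤ (‖ε‖ - c * ‖v‖) ^ 2 / (2 * c) := by positivity
    linarith

/-- The progress made in a single step of the intermediate gradient method. -/
theorem one_step {f h : E → ℝ} {Q : Set E} (hh : ConvexOn ℝ Q h) {δ L : ℝ} {fδ : E → ℝ}
    {gδ : E → StrongDual ℝ E} (ho : IsInexactOracle Q f δ L fδ gδ)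
    {x' y z xh w : E} {γ : StrongDual ℝ E} {α B β ρ breg : ℝ}
    (hx : x' ∈ Q) (hy : y ∈ Q) (hxh : xh ∈ Q) (hα : 0 ≤ α) (hB : 0 < B) (hαB : α ≤ B)
    (hsq : α ^ 2 ≤ B) (hρ : 0 ≤ ρ) (hβ : 0 ≤ β) (hc : 0 ≤ ρ * β - L)
    (hε : ρ * β - L = 0 → γ - gδ x' = 0)
    (hx' : x' = (α / B) • z + (1 - α / B) • y) (hw : w = (α / B) • xh + (1 - α / B) • y)
    (hbreg : ρ / 2 * ‖xh - z‖ ^ 2 ≤ breg) :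
    w ∈ Q ∧ B * (f w + h w) ≤ (B - α) * (f y + h y) + β * breg
      + α * (fδ x' + γ (xh - x') + h xh)
      + B * (δ + ‖γ - gδ x'‖ ^ 2 / (2 * (ρ * β - L))) - α * (γ - gδ x') (z - x') := by
  have hτ0 : 0 ≤ α / B := by positivity
  have hτ1 : α / B ≤ 1 := by rw [div_le_one hB]; exact hαB
  have hwQ : w ∈ Q := by rw [hw]; exact hh.1 hxh hy hτ0 (by linarith) (by ring)
  refine ⟨hwQ, ?_⟩
  have hαe : α = B * (α / B) := by field_simp
  set τ := α / B with hτ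
  have hwx : w - x' = τ • (xh - z) := by rw [hw, hx']; module
  have h1 := (ho x' hx y hy).1
  have h2 := (ho x' hx w hwQ).2
  rw [norm_sub_rev] at h2
  have h4 : h w ≤ τ * h xh + (1 - τ) * h y := by
    rw [hw]; exact hh.2 hxh hy hτ0 (by linarith) (by ring)
  have h7 := neg_apply_le_young (γ - gδ x') (w - x') hc hε
  set e := ‖γ - gδ x'‖ ^ 2 / (2 * (ρ * β - L))
  have hg : gδ x' (w - x') = τ * gδ x' (xh - x') + (1 - τ) * gδ x' (y - x') := by
    have : w - x' = τ • (xh - x') + (1 - τ) • (y - x') := by rw [hw]; module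
    rw [this]; simp
  have he : (γ - gδ x') (w - x') = τ * ((γ - gδ x') (xh - x') - (γ - gδ x') (z - x')) := by
    rw [hwx, ← map_sub, sub_sub_sub_cancel_right, map_smul, smul_eq_mul]
  have hγ : γ (xh - x') = gδ x' (xh - x') + (γ - gδ x') (xh - x') := by simp
  -- `w - x'` is `τ (xh - z)` and `B τ² = α² / B ≤ 1`, so the quadratic error at `w`, weighted by
  -- `B`, is paid for by a single Bregman distance from `z`.
  have hn : B * ‖w - x'‖ ^ 2 ≤ ‖xh - z‖ ^ 2 := by
    rw [hwx, norm_smul, mul_pow, Real.norm_eq_abs, sq_abs, hτ, div_pow]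
    have : B * (α ^ 2 / B ^ 2 * ‖xh - z‖ ^ 2) = α ^ 2 / B * ‖xh - z‖ ^ 2 := by field_simp
    rw [this]
    have h5 : α ^ 2 / B ≤ 1 := by rw [div_le_one hB]; exact hsq
    nlinarith [sq_nonneg ‖xh - z‖]
  have hb : β * ρ / 2 * (B * ‖w - x'‖ ^ 2) ≤ β * breg := by
    have h5 : β * (ρ / 2 * ‖xh - z‖ ^ 2) ≤ β * breg := mul_le_mul_of_nonneg_left hbreg hβ
    have h6 : β * ρ / 2 * (B * ‖w - x'‖ ^ 2) ≤ β * ρ / 2 * ‖xh - z‖ ^ 2 :=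
      mul_le_mul_of_nonneg_left hn (by positivity)
    linarith
  have key : f w + h w ≤ (1 - τ) * (f y + h y) + β * ρ / 2 * ‖w - x'‖ ^ 2
      + τ * (fδ x' + γ (xh - x') + h xh) + (δ + e) - τ * (γ - gδ x') (z - x') := by
    -- The lower oracle bound at `y` replaces the linear model at `y` by `f y`.
    have h1' : 0 ≤ (1 - τ) * (f y - fδ x' - gδ x' (y - x')) := mul_nonneg (by linarith) h1
    rw [hγ]
    rw [he] at h7
    linarith
  have key2 := mul_le_mul_of_nonneg_left key hB.le
  rw [hαe]
  linarith

/-- The auxiliary points `x 0, z 0, z 1, …` at which the noise terms are tested. -/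
def prevPoint (x z : ℕ → E) : ℕ → E
  | 0 => x 0
  | l + 1 => z l

/-- The accumulated error of the intermediate gradient method. -/
def accError (α β B : ℕ → ℝ) (ρ L δ : ℝ) (ε : ℕ → StrongDual ℝ E) (x z : ℕ → E) (i : ℕ) : ℝ :=
  -- The truncated `l - 1` gives `β 0` for `l = 0`, the weight used for `y 0`; for `l ≥ 1` it is the
  -- weight in the subproblem of `xhat l`.
  ∑ l ∈ Finset.range (i + 1), B l * (δ + ‖ε l‖ ^ 2 / (2 * (ρ * β (l - 1) - L)))
    - ∑ l ∈ Finset.range (i + 1), α l * ε l (prevPoint x z l - x l)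

/-- Conditions on the coefficient sequences. -/
structure IsAdmissible (α β B : ℕ → ℝ) (ρ L : ℝ) : Prop where
  rho_pos : 0 < ρ
  alpha_pos : ∀ i, 0 < α i
  alpha_le : ∀ i, α i ≤ B i
  alpha_sq_le : ∀ i, α i ^ 2 ≤ B i
  le_sum : ∀ i, B i ≤ ∑ l ∈ Finset.range (i + 1), α l
  beta_nonneg : ∀ i, 0 ≤ β i
  beta_mono : ∀ i, β i ≤ β (i + 1)
  le_beta : ∀ i, 0 ≤ ρ * β i - L
  alpha_zero : B 0 = α 0
  alpha_zero_le : α 0 ≤ 1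

namespace IsSIGMRun

variable {Q : Set E} {h : E → ℝ} {α β B : ℕ → ℝ} {D : E → ℝ} {n : ℕ}
  {γ : ℕ → StrongDual ℝ E} {x y z xhat w : ℕ → E}

/-- Brings the subproblem to the form `β D + affine + A h`, to which both the three-point inequality
and the measurability of minimizers apply. -/
theorem z_argmin' (hr : IsSIGMRun Q h α β B D n γ x y z xhat w) {i : ℕ} (hi : i < n) :
    IsArgmin (fun v => β i * D v + ((∑ l ∈ Finset.range (i + 1), α l • γ l) v
      + -(∑ l ∈ Finset.range (i + 1), α l * γ l (x l))
      + (∑ l ∈ Finset.range (i + 1), α l) * h v)) Q (z i) := by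
  have := hr.z_argmin i hi
  simp only [sum_smul_apply_sub, add_assoc] at this ⊢
  exact this

theorem xhat_argmin' (hr : IsSIGMRun Q h α β B D n γ x y z xhat w) {i : ℕ} (hi : i < n) :
    IsArgmin (fun v => β i * D v + ((α (i + 1) • γ (i + 1) - β i • fderiv ℝ D (z i)) v
      + -(β i * D (z i) - β i * fderiv ℝ D (z i) (z i) + α (i + 1) * γ (i + 1) (z i))
      + α (i + 1) * h v)) Q (xhat (i + 1)) := by
  have := hr.xhat_argmin i hi
  convert this using 2 with v
  simp only [bregman, map_sub, sub_apply, smul_apply,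
    smul_eq_mul]
  ring

theorem y_zero' (hr : IsSIGMRun Q h α β B D n γ x y z xhat w) :
    IsArgmin (fun v => β 0 * D v + ((α 0 • γ 0) v + -(α 0 * γ 0 (x 0)) + α 0 * h v)) Q (y 0) := by
  have := hr.y_zero
  convert this using 2 with v
  simp only [map_sub, smul_apply, smul_eq_mul]
  ring

theorem mem (hr : IsSIGMRun Q h α β B D n γ x y z xhat w) {ρ L : ℝ} (hQ : Convex ℝ Q)
    (hc : IsAdmissible α β B ρ L) : ∀ i ≤ n, x i ∈ Q ∧ y i ∈ Q := by
  intro i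
  induction i with
  | zero => exact fun _ => ⟨hr.x_zero.1, hr.y_zero.1⟩
  | succ i ih =>
    intro hi
    have hy := (ih (by omega)).2
    have hi' : i < n := hi
    have hα := hc.alpha_pos (i + 1)
    have hB : 0 < B (i + 1) := hα.trans_le (hc.alpha_le _)
    have hτ0 : 0 ≤ α (i + 1) / B (i + 1) := by positivity
    have hτ1 : α (i + 1) / B (i + 1) ≤ 1 := by rw [div_le_one hB]; exact hc.alpha_le _
    have hw : w (i + 1) ∈ Q := by
      rw [hr.w_succ i hi']
      exact hQ (hr.xhat_argmin i hi').1 hy hτ0 (by linarith) (by ring)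
    constructor
    · rw [hr.x_succ i hi']
      exact hQ (hr.z_argmin i hi').1 hy hτ0 (by linarith) (by ring)
    · rw [hr.y_succ i hi']
      have hA : 0 < ∑ l ∈ Finset.range (i + 2), α l := hB.trans_le (hc.le_sum (i + 1))
      refine hQ hy hw (div_nonneg ?_ hA.le) (by positivity) (by field_simp; ring)
      linarith [hc.le_sum (i + 1)]

/-- The bound is stated for all `v` in `Q` because `z n` is not computed, while the induction step
needs it at `z i`. There the three-point inequality for `z i` produces `β i` times the Bregman
distance from `z i` to `v`, which is exactly what the optimality of `xhat (i + 1)` consumes. -/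
theorem estimate (hr : IsSIGMRun Q h α β B D n γ x y z xhat w) {f : E → ℝ}
    (hf : ConvexOn ℝ Q f) (hh : ConvexOn ℝ Q h) {δ L ρ : ℝ} {fδ : E → ℝ}
    {gδ : E → StrongDual ℝ E} (ho : IsInexactOracle Q f δ L fδ gδ)
    (hc : IsAdmissible α β B ρ L) (hD : Differentiable ℝ D)
    (hbreg : ∀ u v, ρ / 2 * ‖u - v‖ ^ 2 ≤ bregman D u v) (hD0 : D (x 0) = 0)
    (hDnn : ∀ v, 0 ≤ D v)
    (hε : ∀ l ≤ n, ρ * β (l - 1) - L = 0 → γ l - gδ (x l) = 0) :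
    ∀ i ≤ n, ∀ v ∈ Q, (∑ l ∈ Finset.range (i + 1), α l) * (f (y i) + h (y i)) ≤
      β i * D v + ∑ l ∈ Finset.range (i + 1), α l * γ l (v - x l)
        + (∑ l ∈ Finset.range (i + 1), α l) * h v + ∑ l ∈ Finset.range (i + 1), α l * fδ (x l)
        + accError α β B ρ L δ (fun l => γ l - gδ (x l)) x z i := by
  intro i
  induction i with
  | zero =>
    intro _ v hv
    have hx0 := hr.x_zero.1
    have hy0 := hr.y_zero.1
    have h1 := (ho (x 0) hx0 (y 0) hy0).2
    have h2 := neg_apply_le_young (γ 0 - gδ (x 0)) (y 0 - x 0) (hc.le_beta 0)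
      (hε 0 (by omega))
    have h3 : ρ / 2 * ‖y 0 - x 0‖ ^ 2 ≤ D (y 0) := by
      have h4 := hbreg (y 0) (x 0)
      -- `x 0` minimizes `D` over the whole space, hence `D` itself is the Bregman distance from `x
      -- 0`.
      have h5 : fderiv ℝ D (x 0) = 0 :=
        IsLocalMin.fderiv_eq_zero (Filter.Eventually.of_forall fun v => by rw [hD0]; exact hDnn v)
      rw [bregman, h5, hD0] at h4
      simpa using h4
    have h6 : β 0 * D (y 0) + α 0 * γ 0 (y 0 - x 0) + α 0 * h (y 0)
      ≤ β 0 * D v + α 0 * γ 0 (v - x 0) + α 0 * h v := hr.y_zero.2 hv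
    have hα := hc.alpha_pos 0
    have h7 : α 0 * (β 0 * D (y 0)) ≤ β 0 * D (y 0) :=
      mul_le_of_le_one_left (mul_nonneg (hc.beta_nonneg 0) (hDnn _)) hc.alpha_zero_le
    have h8 : β 0 * (ρ / 2 * ‖y 0 - x 0‖ ^ 2) ≤ β 0 * D (y 0) :=
      mul_le_mul_of_nonneg_left h3 (hc.beta_nonneg 0)
    simp only [accError, zero_add, Finset.sum_range_one, prevPoint, sub_self, map_zero, mul_zero,
      sub_zero, zero_tsub, hc.alpha_zero]
    rw [norm_sub_rev] at h1
    have h9 : f (y 0) + h (y 0) ≤ β 0 * D (y 0) + γ 0 (y 0 - x 0) + h (y 0) + fδ (x 0)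
        + (δ + ‖γ 0 - gδ (x 0)‖ ^ 2 / (2 * (ρ * β 0 - L))) := by
      rw [sub_apply] at h2
      linarith
    have h10 := mul_le_mul_of_nonneg_left h9 hα.le
    linarith
  | succ i ih =>
    intro hi v hv
    have hi' : i < n := hi
    have ihz := ih hi'.le (z i) (hr.z_argmin i hi').1
    have hmem := hr.mem hf.1 hc i hi'.le
    have hmem' := hr.mem hf.1 hc (i + 1) hi
    have hα := hc.alpha_pos (i + 1)
    have hB : 0 < B (i + 1) := hα.trans_le (hc.alpha_le _)
    have hA0 : 0 ≤ ∑ l ∈ Finset.range (i + 1), α l :=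
      Finset.sum_nonneg fun l _ => (hc.alpha_pos l).le
    have hxh := (hr.xhat_argmin i hi').1
    obtain ⟨hwQ, hstep⟩ := one_step hh ho hmem'.1 hmem.2 hxh hα.le hB (hc.alpha_le _)
      (hc.alpha_sq_le _) hc.rho_pos.le (hc.beta_nonneg i) (hc.le_beta i) (hε (i + 1) hi)
      (hr.x_succ i hi') (hr.w_succ i hi') (hbreg (xhat (i + 1)) (z i))
    have h3 := IsArgmin.add_bregman_le (convexOn_affine_add hh hA0 _ _) (hD (z i))
      (hr.z_argmin' hi') hv
    rw [← sum_smul_apply_sub, ← sum_smul_apply_sub] at h3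
    have h4 : β i * bregman D (xhat (i + 1)) (z i) + α (i + 1) * γ (i + 1) (xhat (i + 1) - z i)
        + α (i + 1) * h (xhat (i + 1)) ≤ β i * bregman D v (z i)
          + α (i + 1) * γ (i + 1) (v - z i) + α (i + 1) * h v := (hr.xhat_argmin i hi').2 hv
    have h5 : β i * D v ≤ β (i + 1) * D v :=
      mul_le_mul_of_nonneg_right (hc.beta_mono i) (hDnn v)
    have hA : 0 < ∑ l ∈ Finset.range (i + 2), α l := hB.trans_le (hc.le_sum (i + 1))
    have hφ : ConvexOn ℝ Q fun v => f v + h v := hf.add hh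
    have h6 : (∑ l ∈ Finset.range (i + 2), α l) * (f (y (i + 1)) + h (y (i + 1))) ≤
        (∑ l ∈ Finset.range (i + 2), α l - B (i + 1)) * (f (y i) + h (y i))
          + B (i + 1) * (f (w (i + 1)) + h (w (i + 1))) := by
      have ha : 0 ≤ (∑ l ∈ Finset.range (i + 2), α l - B (i + 1))
          / ∑ l ∈ Finset.range (i + 2), α l :=
        div_nonneg (by linarith [hc.le_sum (i + 1)]) hA.le
      have hb : 0 ≤ B (i + 1) / ∑ l ∈ Finset.range (i + 2), α l := by positivity
      have := hφ.2 hmem.2 hwQ ha hb (by field_simp; ring)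
      rw [← hr.y_succ i hi'] at this
      refine (mul_le_mul_of_nonneg_left this hA.le).trans (le_of_eq ?_)
      simp only [smul_eq_mul]
      field_simp
    have e1 : γ (i + 1) (xhat (i + 1) - x (i + 1)) - γ (i + 1) (xhat (i + 1) - z i)
        = γ (i + 1) (v - x (i + 1)) - γ (i + 1) (v - z i) := by
      simp only [map_sub]; ring
    have e1' : α (i + 1) * γ (i + 1) (xhat (i + 1) - x (i + 1))
        = α (i + 1) * γ (i + 1) (xhat (i + 1) - z i)
          + α (i + 1) * γ (i + 1) (v - x (i + 1)) - α (i + 1) * γ (i + 1) (v - z i) := by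
      rw [← mul_add, ← mul_sub]; congr 1; linarith
    simp only [accError] at ihz ⊢
    rw [Finset.sum_range_succ (fun l => α l * γ l (v - x l)),
      Finset.sum_range_succ (fun l => α l * fδ (x l)),
      Finset.sum_range_succ (fun l => B l * _),
      Finset.sum_range_succ (fun l => α l * (γ l - gδ (x l)) (prevPoint x z l - x l))]
    rw [Finset.sum_range_succ α (i + 1)] at h6 ⊢
    rw [Nat.add_sub_cancel, show prevPoint x z (i + 1) = z i from rfl]
    linarith

/-- The pathwise form of the convergence estimate, together with the bound that it gives for the
distance of the auxiliary points to a solution. -/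
theorem gap_le (hr : IsSIGMRun Q h α β B D n γ x y z xhat w) {f : E → ℝ}
    (hf : ConvexOn ℝ Q f) (hh : ConvexOn ℝ Q h) {δ L ρ : ℝ} {fδ : E → ℝ}
    {gδ : E → StrongDual ℝ E} (ho : IsInexactOracle Q f δ L fδ gδ)
    (hc : IsAdmissible α β B ρ L) (hD : Differentiable ℝ D)
    (hbreg : ∀ u v, ρ / 2 * ‖u - v‖ ^ 2 ≤ bregman D u v) (hD0 : D (x 0) = 0)
    (hDnn : ∀ v, 0 ≤ D v)
    (hε : ∀ l ≤ n, ρ * β (l - 1) - L = 0 → γ l - gδ (x l) = 0)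
    {xs : E} (hxs : IsArgmin (fun v => f v + h v) Q xs) :
    ∀ i ≤ n, (∑ l ∈ Finset.range (i + 1), α l) * (f (y i) + h (y i) - (f xs + h xs))
      + (if i < n then β i * (ρ / 2 * ‖xs - z i‖ ^ 2) else 0) ≤
      β i * D xs
        + ∑ l ∈ Finset.range (i + 1),
            B l * (δ + ‖γ l - gδ (x l)‖ ^ 2 / (2 * (ρ * β (l - 1) - L)))
        + ∑ l ∈ Finset.range (i + 1), α l * (γ l - gδ (x l)) (xs - prevPoint x z l) := by
  intro i hi
  have hA0 : 0 ≤ ∑ l ∈ Finset.range (i + 1), α l :=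
    Finset.sum_nonneg fun l _ => (hc.alpha_pos l).le
  have hest := hr.estimate hf hh ho hc hD hbreg hD0 hDnn hε i hi
  -- The lower oracle bound at `xs` replaces the linear models by `f xs`; only the noise survives.
  have h1 : ∑ l ∈ Finset.range (i + 1), α l * γ l (xs - x l)
      + (∑ l ∈ Finset.range (i + 1), α l) * h xs + ∑ l ∈ Finset.range (i + 1), α l * fδ (x l)
      ≤ (∑ l ∈ Finset.range (i + 1), α l) * (f xs + h xs)
        + ∑ l ∈ Finset.range (i + 1), α l * (γ l - gδ (x l)) (xs - x l) := by
    simp only [Finset.sum_mul, ← Finset.sum_add_distrib]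
    refine Finset.sum_le_sum fun l hl => ?_
    have h2 := (ho (x l) (hr.mem hf.1 hc l (by
      have := Finset.mem_range.1 hl; omega)).1 xs hxs.1).1
    have h3 := mul_nonneg (hc.alpha_pos l).le h2
    rw [sub_apply]
    linarith
  have h2 : ∑ l ∈ Finset.range (i + 1), α l * (γ l - gδ (x l)) (xs - prevPoint x z l)
      = ∑ l ∈ Finset.range (i + 1), α l * (γ l - gδ (x l)) (xs - x l)
        - ∑ l ∈ Finset.range (i + 1), α l * (γ l - gδ (x l)) (prevPoint x z l - x l) := by
    rw [← Finset.sum_sub_distrib]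
    refine Finset.sum_congr rfl fun l _ => ?_
    simp only [map_sub]; ring
  have h3 : (∑ l ∈ Finset.range (i + 1), α l) * (f (y i) + h (y i))
      + (if i < n then β i * (ρ / 2 * ‖xs - z i‖ ^ 2) else 0) ≤
      β i * D xs + ∑ l ∈ Finset.range (i + 1), α l * γ l (xs - x l)
        + (∑ l ∈ Finset.range (i + 1), α l) * h xs + ∑ l ∈ Finset.range (i + 1), α l * fδ (x l)
        + accError α β B ρ L δ (fun l => γ l - gδ (x l)) x z i := by
    -- Testing the estimate at `z i` instead of `xs` keeps the distance from `z i` to `xs` on the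
    -- left. For `i = n` there is no `z i`, and `xs` is inserted directly.
    split_ifs with hin
    · have h4 := IsArgmin.add_bregman_le (convexOn_affine_add hh hA0 _ _) (hD (z i))
        (hr.z_argmin' hin) hxs.1
      rw [← sum_smul_apply_sub, ← sum_smul_apply_sub] at h4
      have h5 := hest (z i) (hr.z_argmin i hin).1
      have h6 := mul_le_mul_of_nonneg_left (hbreg xs (z i)) (hc.beta_nonneg i)
      linarith
    · simpa using hest xs hxs.1
  rw [accError] at h3
  linarith

end IsSIGMRun

end Deterministic

/-! ### Inequalities for the coefficient sequences -/

section Coefficients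

variable {p : ℝ}

theorem one_le_two_rpow (hp : 1 ≤ p) : 1 ≤ (2 : ℝ) ^ ((2 * p - 1) / 2) :=
  Real.one_le_rpow (by norm_num) (by linarith)

theorem one_le_ratio (hp : 1 ≤ p) (i : ℕ) : 1 ≤ (i + p) / p := by
  rw [le_div_iff₀ (by linarith)]
  have : (0 : ℝ) ≤ i := i.cast_nonneg
  linarith

theorem alphaSeq_pos (hp : 1 ≤ p) (i : ℕ) : 0 < alphaSeq p i := by
  have := one_le_ratio hp i
  unfold alphaSeq
  positivity

theorem bSeq_pos (hp : 1 ≤ p) (i : ℕ) : 0 < bSeq p i := by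
  have := one_le_ratio hp i
  unfold bSeq
  positivity

theorem alphaSeq_le_bSeq (hp : 1 ≤ p) (i : ℕ) : alphaSeq p i ≤ bSeq p i := by
  unfold alphaSeq bSeq
  exact mul_le_mul_of_nonneg_left
    (Real.rpow_le_rpow_of_exponent_le (one_le_ratio hp i) (by linarith)) (by positivity)

theorem alphaSeq_sq_le (hp : 1 ≤ p) (i : ℕ) : alphaSeq p i ^ 2 ≤ bSeq p i := by
  have h1 := one_le_ratio hp i
  have ha := one_le_two_rpow hp
  have h2 : (((i : ℝ) + p) / p) ^ (2 * p - 2) = ((((i : ℝ) + p) / p) ^ (p - 1)) ^ 2 := by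
    rw [← Real.rpow_natCast, ← Real.rpow_mul (by linarith)]
    congr 1; push_cast; ring
  unfold alphaSeq bSeq
  rw [h2, mul_pow]
  gcongr
  rw [sq]
  refine mul_le_of_le_one_left (by positivity) ?_
  rw [div_le_one (by linarith)]
  exact ha

/-- With `t = (n + 1 + p) / p`, Bernoulli's inequality gives `(t - 1/p)^p ≥ t^p - t^(p-1)`, so the
increments of `((n + p) / p)^p` are at most the summands `((n + p) / p)^(p-1)`. -/
theorem le_sum_alphaSeq (hp : 1 ≤ p) (n : ℕ) :
    1 / (2 : ℝ) ^ ((2 * p - 1) / 2) * ((n + p) / p) ^ p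
      ≤ ∑ l ∈ Finset.range (n + 1), alphaSeq p l := by
  have hp0 : 0 < p := by linarith
  induction n with
  | zero => simp [alphaSeq, hp0.ne']
  | succ n ih =>
    rw [Finset.sum_range_succ]
    set t : ℝ := ((n + 1 : ℕ) + p) / p with ht
    have ht1 : 1 ≤ t := one_le_ratio hp (n + 1)
    have ht0 : 0 < t := by linarith
    have hs : ((n : ℝ) + p) / p = t * (1 + -(1 / (p * t))) := by
      rw [ht]; push_cast; field_simp; ring
    have hpt : 1 ≤ p * t := one_le_mul_of_one_le_of_one_le hp ht1
    have h1 : -1 ≤ -(1 / (p * t)) := by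
      rw [neg_le_neg_iff, div_le_one (by linarith)]; exact hpt
    have h2 := one_add_mul_self_le_rpow_one_add h1 hp
    have h3 : t ^ p - t ^ (p - 1) ≤ (((n : ℝ) + p) / p) ^ p := by
      rw [hs, Real.mul_rpow ht0.le (by linarith), Real.rpow_sub_one ht0.ne']
      refine le_trans (le_of_eq ?_) (mul_le_mul_of_nonneg_left h2 (by positivity))
      field_simp
      ring
    have h4 : alphaSeq p (n + 1) = 1 / (2 : ℝ) ^ ((2 * p - 1) / 2) * t ^ (p - 1) := rfl
    rw [h4]
    have h5 := mul_le_mul_of_nonneg_left h3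
      (show 0 ≤ 1 / (2 : ℝ) ^ ((2 * p - 1) / 2) by positivity)
    linarith

theorem bSeq_le_sum (hp : 1 ≤ p) (hp2 : p ≤ 2) (n : ℕ) :
    bSeq p n ≤ ∑ l ∈ Finset.range (n + 1), alphaSeq p l := by
  refine le_trans ?_ (le_sum_alphaSeq hp n)
  unfold bSeq
  gcongr
  · exact one_le_ratio hp n
  · linarith

/-- With respect to the norm `‖·‖ / R` and the noise level `s R`, the coefficient sequences are
admissible. -/
theorem isAdmissible_seq (hp : 1 ≤ p) (hp2 : p ≤ 2) {L R s V : ℝ} (hL : 0 < L) (hR : 0 < R)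
    (hs : 0 ≤ s) (hV : 0 < V) :
    IsAdmissible (alphaSeq p) (betaSeq p (L * R ^ 2) (s * R) V) (bSeq p) (R ^ 2)⁻¹ L where
  rho_pos := by positivity
  alpha_pos := alphaSeq_pos hp
  alpha_le := alphaSeq_le_bSeq hp
  alpha_sq_le := alphaSeq_sq_le hp
  le_sum := bSeq_le_sum hp hp2
  beta_nonneg i := by unfold betaSeq; positivity
  beta_mono i := by
    unfold betaSeq
    push_cast
    gcongr
    · linarith
    · linarith
  le_beta i := by
    have h1 : (0 : ℝ) ≤ (2 : ℝ) ^ ((5 - 2 * p) / 4) * p ^ ((1 - 2 * p) / 2) * (s * R) / V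
        * (i + p + 1) ^ ((2 * p - 1) / 2) := by positivity
    have h2 : (R ^ 2)⁻¹ * betaSeq p (L * R ^ 2) (s * R) V i - L
        = (R ^ 2)⁻¹ * ((2 : ℝ) ^ ((5 - 2 * p) / 4) * p ^ ((1 - 2 * p) / 2) * (s * R) / V
        * (i + p + 1) ^ ((2 * p - 1) / 2)) := by
      unfold betaSeq; field_simp; ring
    rw [h2]
    positivity
  alpha_zero := by
    have hp0 : p ≠ 0 := by linarith
    simp [alphaSeq, bSeq, hp0]
  alpha_zero_le := by
    have hp0 : p ≠ 0 := by linarith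
    simp only [alphaSeq, Nat.cast_zero, zero_add, div_self hp0, Real.one_rpow, mul_one]
    rw [div_le_one (by positivity)]
    exact one_le_two_rpow hp

/-- The coefficient of the stochastic term of `betaSeq`. -/
def noiseCoeff (p : ℝ) : ℝ := (2 : ℝ) ^ ((5 - 2 * p) / 4) * p ^ ((1 - 2 * p) / 2)

theorem noiseCoeff_pos (hp : 1 ≤ p) : 0 < noiseCoeff p := by unfold noiseCoeff; positivity

/-- This surplus is the constant in Young's inequality for the noise; for positive `p` and `V` it
vanishes only without noise. -/
theorem betaSeq_sub {L R s V : ℝ} (hR : 0 < R) (i : ℕ) :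
    (R ^ 2)⁻¹ * betaSeq p (L * R ^ 2) (s * R) V i - L
      = noiseCoeff p * s / (R * V) * (i + p + 1) ^ ((2 * p - 1) / 2) := by
  unfold betaSeq noiseCoeff
  rw [mul_add, mul_comm L, inv_mul_cancel_left₀ (by positivity), add_sub_cancel_left]
  field_simp

theorem two_rpow_le_sixteen {x : ℝ} (hx : x ≤ 4) : (2 : ℝ) ^ x ≤ 16 := by
  calc (2 : ℝ) ^ x ≤ (2 : ℝ) ^ (4 : ℝ) := Real.rpow_le_rpow_of_exponent_le (by norm_num) hx
    _ = 16 := by norm_num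

theorem one_le_sqrt_two : (1 : ℝ) ≤ √2 := by
  rw [Real.one_le_sqrt]; norm_num

/-- The contribution of the growth of `β` to the error. -/
theorem noise_beta_le (hp : 1 ≤ p) (hp2 : p ≤ 2) (n : ℕ) :
    noiseCoeff p / 2 * (n + p + 1) ^ ((2 * p - 1) / 2) * √n
      ≤ C₂ / 2 * ∑ l ∈ Finset.range (n + 1), alphaSeq p l := by
  have hp0 : 0 < p := by linarith
  have hn : (0 : ℝ) ≤ n := n.cast_nonneg
  have hq : 0 < (n : ℝ) + p := by linarith
  have hC : (16 : ℝ) ≤ C₂ := by unfold C₂; linarith [one_le_sqrt_two]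
  have h1 : ((n : ℝ) + p + 1) ^ ((2 * p - 1) / 2)
      ≤ (2 : ℝ) ^ ((2 * p - 1) / 2) * (n + p) ^ ((2 * p - 1) / 2) := by
    rw [← Real.mul_rpow (by norm_num) hq.le]
    exact Real.rpow_le_rpow (by linarith) (by linarith) (by linarith)
  have h2 : √(n : ℝ) ≤ (n + p) ^ (1 / 2 : ℝ) := by
    rw [← Real.sqrt_eq_rpow]; exact Real.sqrt_le_sqrt (by linarith)
  have h3 : ((n : ℝ) + p) ^ ((2 * p - 1) / 2) * (n + p) ^ (1 / 2 : ℝ) = (n + p) ^ p := by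
    rw [← Real.rpow_add hq]; congr 1; ring
  -- Bounding `p` by `2` leaves a power of `2` with exponent `3/4 + 3p/2`, which is at most `4`;
  -- this is the room provided by `C₂`.
  have h4 : noiseCoeff p * (2 : ℝ) ^ ((2 * p - 1) / 2) * (2 : ℝ) ^ ((2 * p - 1) / 2) * p ^ p
      ≤ 16 := by
    have e : noiseCoeff p * (2 : ℝ) ^ ((2 * p - 1) / 2) * (2 : ℝ) ^ ((2 * p - 1) / 2) * p ^ p
        = (2 : ℝ) ^ ((5 - 2 * p) / 4 + (2 * p - 1) / 2 + (2 * p - 1) / 2)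
          * p ^ ((1 - 2 * p) / 2 + p) := by
      rw [Real.rpow_add two_pos, Real.rpow_add two_pos, Real.rpow_add hp0, noiseCoeff]; ring
    rw [e]
    calc _ ≤ (2 : ℝ) ^ ((5 - 2 * p) / 4 + (2 * p - 1) / 2 + (2 * p - 1) / 2)
          * (2 : ℝ) ^ ((1 - 2 * p) / 2 + p) := by
          exact mul_le_mul_of_nonneg_left (Real.rpow_le_rpow hp0.le hp2 (by linarith))
            (by positivity)
      _ = (2 : ℝ) ^ ((5 - 2 * p) / 4 + (2 * p - 1) / 2 + (2 * p - 1) / 2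
            + ((1 - 2 * p) / 2 + p)) := (Real.rpow_add two_pos _ _).symm
      _ ≤ 16 := two_rpow_le_sixteen (by linarith)
  have hA := le_sum_alphaSeq hp n
  set a : ℝ := (2 : ℝ) ^ ((2 * p - 1) / 2) with ha
  have ha0 : 0 < a := by positivity
  have hb := noiseCoeff_pos hp
  calc noiseCoeff p / 2 * (n + p + 1) ^ ((2 * p - 1) / 2) * √n
      ≤ noiseCoeff p / 2 * (a * (n + p) ^ ((2 * p - 1) / 2)) * (n + p) ^ (1 / 2 : ℝ) := by
        gcongr
    _ = noiseCoeff p / 2 * a * (n + p) ^ p := by rw [← h3]; ring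
    _ = noiseCoeff p * a * a * p ^ p / 2 * (1 / a * ((n + p) / p) ^ p) := by
        rw [Real.div_rpow hq.le hp0.le]; field_simp
    _ ≤ C₂ / 2 * ∑ l ∈ Finset.range (n + 1), alphaSeq p l := by
        gcongr
        linarith

theorem sum_inv_sqrt_le (n : ℕ) :
    ∑ l ∈ Finset.range n, (√((l : ℝ) + 1))⁻¹ ≤ 2 * √(n : ℝ) := by
  induction n with
  | zero => simp
  | succ n ih =>
    rw [Finset.sum_range_succ]
    push_cast
    have hn : (0 : ℝ) ≤ n := n.cast_nonneg
    have h1 := Real.sq_sqrt hn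
    have h2 := Real.sq_sqrt (show (0 : ℝ) ≤ n + 1 by linarith)
    have h3 : 0 < √((n : ℝ) + 1) := Real.sqrt_pos.2 (by linarith)
    have h4 : (√((n : ℝ) + 1))⁻¹ ≤ 2 * (√((n : ℝ) + 1) - √n) := by
      rw [inv_le_iff_one_le_mul₀' h3]
      nlinarith [sq_nonneg (√((n : ℝ) + 1) - √n)]
    linarith

/-- The contribution of the variance of the oracle to the error. -/
theorem noise_variance_le (hp : 1 ≤ p) (hp2 : p ≤ 2) (n : ℕ) :
    (∑ l ∈ Finset.range (n + 1), bSeq p l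
        / (2 * noiseCoeff p * (((l - 1 : ℕ) : ℝ) + p + 1) ^ ((2 * p - 1) / 2))) * √n
      ≤ C₂ / 2 * ∑ l ∈ Finset.range (n + 1), alphaSeq p l := by
  have hp0 : 0 < p := by linarith
  have hn : (0 : ℝ) ≤ n := n.cast_nonneg
  have hq : 0 < (n : ℝ) + p := by linarith
  have hC : (8 : ℝ) ≤ C₂ / 2 := by unfold C₂; linarith [one_le_sqrt_two]
  have hb := noiseCoeff_pos hp
  have hA := le_sum_alphaSeq hp n
  have hp22 : 0 < p ^ (2 * p - 2) := by positivity
  set a : ℝ := (2 : ℝ) ^ ((2 * p - 1) / 2) with ha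
  have ha0 : 0 < a := by positivity
  have hterm : ∀ l ∈ Finset.range (n + 1), bSeq p l
        / (2 * noiseCoeff p * (((l - 1 : ℕ) : ℝ) + p + 1) ^ ((2 * p - 1) / 2))
      ≤ (n + p) ^ (p - 1) / (2 * a * noiseCoeff p * p ^ (2 * p - 2)) * (√((l : ℝ) + 1))⁻¹ := by
    intro l hl
    have hl0 : (0 : ℝ) ≤ l := l.cast_nonneg
    have hln : (l : ℝ) ≤ n := by
      have := Finset.mem_range.1 hl
      exact_mod_cast (by omega : l ≤ n)
    have hlp : 0 < (l : ℝ) + p := by linarith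
    have hl1 : (l : ℝ) + p ≤ ((l - 1 : ℕ) : ℝ) + p + 1 := by
      have : (l : ℝ) ≤ ((l - 1 : ℕ) : ℝ) + 1 := by exact_mod_cast (by omega : l ≤ l - 1 + 1)
      linarith
    -- Dividing by the power in `β` leaves `(l + p)^(p-1) / √(l + p)`: the first factor is bounded
    -- by its value at `n`, the second is summed to order `√n`.
    have e1 : ((l : ℝ) + p) ^ (2 * p - 2)
        = (l + p) ^ (p - 1) * (√(l + p))⁻¹ * (l + p) ^ ((2 * p - 1) / 2) := by
      rw [Real.sqrt_eq_rpow, ← Real.rpow_neg hlp.le, ← Real.rpow_add hlp, ← Real.rpow_add hlp]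
      congr 1; ring
    calc bSeq p l / (2 * noiseCoeff p * (((l - 1 : ℕ) : ℝ) + p + 1) ^ ((2 * p - 1) / 2))
        ≤ bSeq p l / (2 * noiseCoeff p * ((l : ℝ) + p) ^ ((2 * p - 1) / 2)) := by
          have := (bSeq_pos hp l).le
          gcongr
          linarith
      _ = (l + p) ^ (p - 1) / (2 * a * noiseCoeff p * p ^ (2 * p - 2)) * (√((l : ℝ) + p))⁻¹ := by
          rw [bSeq, ← ha, Real.div_rpow hlp.le hp0.le, e1]
          field_simp
      _ ≤ _ := by gcongr
  have hsum : ∑ l ∈ Finset.range (n + 1), bSeq p l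
        / (2 * noiseCoeff p * (((l - 1 : ℕ) : ℝ) + p + 1) ^ ((2 * p - 1) / 2))
      ≤ (n + p) ^ (p - 1) / (2 * a * noiseCoeff p * p ^ (2 * p - 2)) * (2 * √(n + 1)) := by
    refine (Finset.sum_le_sum hterm).trans ?_
    rw [← Finset.mul_sum]
    have := sum_inv_sqrt_le (n + 1)
    push_cast at this
    gcongr
  have hsq : √((n : ℝ) + 1) * √n ≤ n + p := by
    have h1 : √(n : ℝ) ≤ √(n + 1) := Real.sqrt_le_sqrt (by linarith)
    have h2 := Real.mul_self_sqrt (show (0 : ℝ) ≤ n + 1 by linarith)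
    nlinarith [Real.sqrt_nonneg ((n : ℝ) + 1)]
  have hcoef : p ^ p ≤ 8 * (noiseCoeff p * p ^ (2 * p - 2)) := by
    have e1 : p ^ p = p ^ (3 / 2 : ℝ) * p ^ ((1 - 2 * p) / 2) * p ^ (2 * p - 2) := by
      rw [← Real.rpow_add hp0, ← Real.rpow_add hp0]; congr 1; ring
    have h2 : p ^ (3 / 2 : ℝ) ≤ 8 * (2 : ℝ) ^ ((5 - 2 * p) / 4) := by
      have h3 : p ^ (3 / 2 : ℝ) ≤ (2 : ℝ) ^ (3 : ℝ) :=
        (Real.rpow_le_rpow hp0.le hp2 (by norm_num)).trans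
          (Real.rpow_le_rpow_of_exponent_le (by norm_num) (by norm_num))
      have h4 : 1 ≤ (2 : ℝ) ^ ((5 - 2 * p) / 4) :=
        Real.one_le_rpow (by norm_num) (by linarith)
      norm_num at h3
      linarith
    rw [e1, noiseCoeff]
    have := mul_le_mul_of_nonneg_right h2
      (show 0 ≤ p ^ ((1 - 2 * p) / 2) * p ^ (2 * p - 2) by positivity)
    linarith
  calc _ ≤ (n + p) ^ (p - 1) / (2 * a * noiseCoeff p * p ^ (2 * p - 2)) * (2 * √(n + 1)) * √n := by
        gcongr
    _ = (n + p) ^ (p - 1) / (a * noiseCoeff p * p ^ (2 * p - 2)) * (√(n + 1) * √n) := by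
        field_simp
    _ ≤ (n + p) ^ (p - 1) / (a * noiseCoeff p * p ^ (2 * p - 2)) * (n + p) := by gcongr
    _ = p ^ p / (noiseCoeff p * p ^ (2 * p - 2)) * (1 / a * ((n + p) / p) ^ p) := by
        rw [Real.div_rpow hq.le hp0.le, Real.rpow_sub_one hq.ne']
        field_simp
    _ ≤ C₂ / 2 * ∑ l ∈ Finset.range (n + 1), alphaSeq p l := by
        refine mul_le_mul ?_ hA (by positivity) (by linarith)
        rw [div_le_iff₀ (by positivity)]
        have : 0 < noiseCoeff p * p ^ (2 * p - 2) := by positivity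
        nlinarith

/-- The contribution of the initial distance to the error. -/
theorem rpow_le_sum_alphaSeq (hp : 1 ≤ p) (hp2 : p ≤ 2) (n : ℕ) :
    (n : ℝ) ^ p ≤ 2 * C₁ * ∑ l ∈ Finset.range (n + 1), alphaSeq p l := by
  have hp0 : 0 < p := by linarith
  have hn : (0 : ℝ) ≤ n := n.cast_nonneg
  have hq : 0 < (n : ℝ) + p := by linarith
  have hA := le_sum_alphaSeq hp n
  set a : ℝ := (2 : ℝ) ^ ((2 * p - 1) / 2) with ha
  have ha0 : 0 < a := by positivity
  -- The left side is largest at `p = 2`, where it equals `8√2 = 2 C₁`.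
  have h1 : a * p ^ p ≤ 2 * C₁ := by
    calc a * p ^ p ≤ (2 : ℝ) ^ (3 / 2 : ℝ) * (2 : ℝ) ^ (2 : ℝ) := by
          rw [ha]
          gcongr
          · norm_num
          · linarith
          · exact (Real.rpow_le_rpow hp0.le hp2 hp0.le).trans
              (Real.rpow_le_rpow_of_exponent_le (by norm_num) hp2)
      _ = 2 * C₁ := by
          have : (2 : ℝ) ^ (3 / 2 : ℝ) = 2 * √2 := by
            rw [Real.sqrt_eq_rpow, show (3 / 2 : ℝ) = 1 + 1 / 2 by norm_num,
              Real.rpow_add two_pos, Real.rpow_one]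
          rw [this, C₁]; norm_num; ring
  calc (n : ℝ) ^ p ≤ (n + p) ^ p := Real.rpow_le_rpow hn (by linarith) hp0.le
    _ = a * p ^ p * (1 / a * ((n + p) / p) ^ p) := by
        rw [Real.div_rpow hq.le hp0.le]; field_simp
    _ ≤ _ := mul_le_mul h1 hA (by positivity) (by unfold C₁; positivity)

/-- The contribution of the bias of the oracle to the error. -/
theorem sum_bSeq_le (hp : 1 ≤ p) (hp2 : p ≤ 2) {κ : ℝ} (hκ : 0 < κ)
    (hκp : 1 < p → 1 / 2 ≤ κ ^ (1 / p)) :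
    ∑ l ∈ Finset.range (⌈κ ^ (1 / p)⌉₊ + 1), bSeq p l
      ≤ 6 * κ ^ ((p - 1) / p) * ∑ l ∈ Finset.range (⌈κ ^ (1 / p)⌉₊ + 1), alphaSeq p l := by
  have hp0 : 0 < p := by linarith
  have hκ1 : 0 < κ ^ (1 / p) := by positivity
  have hn1 : 1 ≤ ⌈κ ^ (1 / p)⌉₊ := Nat.one_le_iff_ne_zero.2 (Nat.ceil_pos.2 hκ1).ne'
  have hlt := Nat.ceil_lt_add_one hκ1.le
  set n := ⌈κ ^ (1 / p)⌉₊
  have hnr : (1 : ℝ) ≤ n := by exact_mod_cast hn1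
  have hS : 0 ≤ ∑ l ∈ Finset.range (n + 1), alphaSeq p l :=
    Finset.sum_nonneg fun l _ => (alphaSeq_pos hp l).le
  rcases hp.eq_or_lt with rfl | hp1
  -- For `p = 1` the two sequences coincide and the power of `κ` is `1`, so no lower bound on `κ` is
  -- required.
  · have e : ∀ l, bSeq 1 l = alphaSeq 1 l := fun l => by simp [bSeq, alphaSeq]
    simp only [e, sub_self, zero_div, Real.rpow_zero]
    linarith
  have hA := le_sum_alphaSeq hp n
  set a : ℝ := (2 : ℝ) ^ ((2 * p - 1) / 2) with ha
  have ha0 : 0 < a := by positivity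
  set r : ℝ := (n + p) / p with hr
  have hr1 : 1 ≤ r := one_le_ratio hp n
  have hr0 : 0 < r := by linarith
  have hsum : ∑ l ∈ Finset.range (n + 1), bSeq p l ≤ (n + 1) * (1 / a * r ^ (2 * p - 2)) := by
    have : ∀ l ∈ Finset.range (n + 1), bSeq p l ≤ 1 / a * r ^ (2 * p - 2) := by
      intro l hl
      have hln : (l : ℝ) ≤ n := by
        have := Finset.mem_range.1 hl
        exact_mod_cast (by omega : l ≤ n)
      rw [bSeq, ← ha, hr]
      gcongr
      linarith
    refine (Finset.sum_le_sum this).trans (le_of_eq ?_)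
    simp
  have hhalf : ((n : ℝ) + 1) / 2 ≤ r := by
    rw [hr, div_le_div_iff₀ two_pos hp0]
    nlinarith
  -- The exponent `p - 2` is not positive, so a lower bound on `r` is what is wanted.
  have h1 : r ^ (p - 2) ≤ (((n : ℝ) + 1) / 2) ^ (p - 2) :=
    Real.rpow_le_rpow_of_nonpos (by positivity) hhalf (by linarith)
  have h2 : ((n : ℝ) + 1) * (((n : ℝ) + 1) / 2) ^ (p - 2) = 2 * (((n : ℝ) + 1) / 2) ^ (p - 1) := by
    rw [show p - 1 = (p - 2) + 1 by ring, Real.rpow_add_one (by positivity)]; ring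
  -- Here `κ^(1/p) ≥ 1/2` enters: `(n + 1) / 2 ≤ κ^(1/p) / 2 + 1 ≤ 3 κ^(1/p)`.
  have h3 : (((n : ℝ) + 1) / 2) ^ (p - 1) ≤ 3 * κ ^ ((p - 1) / p) := by
    calc (((n : ℝ) + 1) / 2) ^ (p - 1) ≤ (3 * κ ^ (1 / p)) ^ (p - 1) := by
          apply Real.rpow_le_rpow (by positivity) _ (by linarith)
          linarith [hκp hp1]
      _ = 3 ^ (p - 1) * κ ^ ((p - 1) / p) := by
          rw [Real.mul_rpow (by norm_num) hκ1.le, ← Real.rpow_mul hκ.le]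
          congr 2; ring
      _ ≤ 3 * κ ^ ((p - 1) / p) := by
          gcongr
          calc (3 : ℝ) ^ (p - 1) ≤ 3 ^ (1 : ℝ) :=
                Real.rpow_le_rpow_of_exponent_le (by norm_num) (by linarith)
            _ = 3 := Real.rpow_one _
  have h4 : ((n : ℝ) + 1) * r ^ (p - 2) ≤ 6 * κ ^ ((p - 1) / p) := by
    calc ((n : ℝ) + 1) * r ^ (p - 2) ≤ (n + 1) * (((n : ℝ) + 1) / 2) ^ (p - 2) := by gcongr
      _ ≤ _ := by rw [h2]; linarith
  calc _ ≤ _ := hsum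
    _ = (n + 1) * r ^ (p - 2) * (1 / a * r ^ p) := by
        rw [show 2 * p - 2 = (p - 2) + p by ring, Real.rpow_add hr0]; ring
    _ ≤ _ := by gcongr

end Coefficients

/-! ### Stability and measurability of the minimizers -/

section ArgminMeasurable

variable {E : Type*} [NormedAddCommGroup E] [InnerProductSpace ℝ E]

theorem IsProxFunction.convexOn_rescaled {d : E → ℝ} (hd : IsProxFunction d) (u : E) (R : ℝ) :
    ConvexOn ℝ Set.univ fun v => d (R⁻¹ • (v - u)) := by
  have h1 : ConvexOn ℝ Set.univ d := hd.strongConvex.convexOn fun r => by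
    simp only [Pi.zero_apply]; positivity
  refine ⟨convex_univ, fun x _ y _ a b ha hb hab => ?_⟩
  have h2 : R⁻¹ • (a • x + b • y - u) = a • (R⁻¹ • (x - u)) + b • (R⁻¹ • (y - u)) := by
    have : u = (a + b) • u := by rw [hab, one_smul]
    nth_rewrite 1 [this]
    module
  simp only [h2]
  exact h1.2 (Set.mem_univ _) (Set.mem_univ _) ha hb hab

/-- The minimizers of a strongly convex function depend continuously on the centre of the
prox-function and on the linear term, provided that they exist. -/
theorem argmin_stable [FiniteDimensional ℝ E] {d : E → ℝ} (hd : IsProxFunction d) {Q : Set E}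
    {h : E → ℝ} (hh : ConvexOn ℝ Q h) {β A R : ℝ} (hβ : 0 < β) (hA : 0 ≤ A) (hR : 0 < R)
    {u₀ z₀ : E} {S₀ : StrongDual ℝ E} {c₀ : ℝ}
    (hz₀ : IsArgmin (fun v => β * d (R⁻¹ • (v - u₀)) + (S₀ v + c₀ + A * h v)) Q z₀)
    {ε : ℝ} (hε : 0 < ε) :
    ∀ᶠ θ : E × StrongDual ℝ E in 𝓝 (u₀, S₀), ∀ c : ℝ, ∀ z : E,
      IsArgmin (fun v => β * d (R⁻¹ • (v - θ.1)) + (θ.2 v + c + A * h v)) Q z →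
        ‖z - z₀‖ ≤ ε := by
  have : ProperSpace E := FiniteDimensional.proper ℝ E
  -- `4 η` is the strong convexity gap at distance `ε` from `z₀`. The perturbed and the original
  -- objective differ on the compact ball by less than `η`, apart from constants; `h` cancels and
  -- need not be continuous.
  set η : ℝ := β * ((R ^ 2)⁻¹ / 2 * ε ^ 2) / 4 with hη
  have hη0 : 0 < η := by positivity
  have hdc : Continuous d := hd.differentiable.continuous
  have hΦ : Continuous fun q : (E × StrongDual ℝ E) × E =>
      β * d (R⁻¹ • (q.2 - q.1.1)) + q.1.2 q.2 := by fun_prop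
  have hΦ₀ : Continuous fun q : (E × StrongDual ℝ E) × E =>
      β * d (R⁻¹ • (q.2 - u₀)) + S₀ q.2 := by fun_prop
  have hunif : ∀ᶠ θ : E × StrongDual ℝ E in 𝓝 (u₀, S₀), ∀ v ∈ Metric.closedBall z₀ ε,
      |(β * d (R⁻¹ • (v - θ.1)) + θ.2 v) - (β * d (R⁻¹ • (v - u₀)) + S₀ v)| < η := by
    refine (isCompact_closedBall z₀ ε).eventually_forall_of_forall_eventually fun v _ => ?_
    have hc := (hΦ.sub hΦ₀).abs.tendsto ((u₀, S₀), v)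
    simp only [Pi.sub_apply, sub_self, abs_zero] at hc
    exact hc.eventually_lt_const hη0
  filter_upwards [hunif] with θ hθ c z hz
  by_contra! hlt
  have hn : 0 < ‖z - z₀‖ := hε.trans hlt
  set t := ε / ‖z - z₀‖ with ht
  have ht0 : 0 ≤ t := by positivity
  have ht1 : t ≤ 1 := by rw [ht, div_le_one hn]; exact hlt.le
  -- The segment to a distant minimizer `z` meets the sphere of radius `ε` at `v`. By convexity the
  -- perturbed objective at `v` does not exceed that at `z₀`, so the original one grows by less than
  -- `2 η`, against the gap `4 η`.
  set v := (1 - t) • z₀ + t • z with hv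
  have hvQ : v ∈ Q := hh.1 hz₀.1 hz.1 (by linarith) ht0 (by ring)
  have hvz : v - z₀ = t • (z - z₀) := by rw [hv]; module
  have hvn : ‖v - z₀‖ = ε := by
    rw [hvz, norm_smul, Real.norm_eq_abs, abs_of_nonneg ht0, ht]; field_simp
  have h1 := hθ v (by rw [Metric.mem_closedBall, dist_eq_norm]; exact hvn.le)
  have h2 := hθ z₀ (Metric.mem_closedBall_self hε.le)
  rw [abs_lt] at h1 h2
  have hconv : ConvexOn ℝ Q fun v => β * d (R⁻¹ • (v - θ.1)) + (θ.2 v + c + A * h v) :=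
    (((hd.convexOn_rescaled θ.1 R).subset (Set.subset_univ _) hh.1).smul hβ.le).add
      (convexOn_affine_add hh hA θ.2 c)
  have h3 := hconv.2 hz₀.1 hz.1 (show 0 ≤ 1 - t by linarith) ht0 (by ring)
  have h4 : β * d (R⁻¹ • (z - θ.1)) + (θ.2 z + c + A * h z)
      ≤ β * d (R⁻¹ • (z₀ - θ.1)) + (θ.2 z₀ + c + A * h z₀) := hz.2 hz₀.1
  rw [← hv] at h3
  simp only [smul_eq_mul] at h3
  have h4' := mul_le_mul_of_nonneg_left h4 ht0
  have h5 := IsArgmin.add_bregman_le (D := fun v => d (R⁻¹ • (v - u₀)))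
    (convexOn_affine_add hh hA S₀ c₀) (differentiable_rescaled hd.differentiable u₀ R z₀) hz₀ hvQ
  have h6 := mul_le_mul_of_nonneg_left (hd.le_bregman_rescaled u₀ R v z₀) hβ.le
  rw [hvn] at h6
  linarith

theorem secondCountable_strongDual [FiniteDimensional ℝ E] :
    SecondCountableTopology (StrongDual ℝ E) :=
  have : ProperSpace (StrongDual ℝ E) := FiniteDimensional.proper ℝ _
  secondCountable_of_proper

theorem secondCountable_space [FiniteDimensional ℝ E] : SecondCountableTopology E :=
  have : ProperSpace E := FiniteDimensional.proper ℝ _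
  secondCountable_of_proper

/-- Stability makes the preimage of an open set under `z` the preimage of an open set of data `(u,
S)`. The constant `c` does not move the minimizer, so it may be arbitrary. -/
theorem measurable_argmin [FiniteDimensional ℝ E] [MeasurableSpace E] [BorelSpace E]
    {d : E → ℝ} (hd : IsProxFunction d) {Q : Set E}
    {h : E → ℝ} (hh : ConvexOn ℝ Q h) {β A R : ℝ} (hβ : 0 < β) (hA : 0 ≤ A) (hR : 0 < R)
    {Ω : Type*} {m : MeasurableSpace Ω} {u z : Ω → E} {S : Ω → StrongDual ℝ E} {c : Ω → ℝ}
    (hu : Measurable u) (hS : Measurable S)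
    (hz : ∀ ω, IsArgmin (fun v => β * d (R⁻¹ • (v - u ω)) + (S ω v + c ω + A * h v)) Q (z ω)) :
    Measurable z := by
  have := secondCountable_strongDual (E := E)
  have := secondCountable_space (E := E)
  refine measurable_of_isOpen fun U hU => ?_
  have key : ∀ ω : z ⁻¹' U, ∃ O : Set (E × StrongDual ℝ E), IsOpen O ∧ (u ω, S ω) ∈ O ∧
      ∀ ω', (u ω', S ω') ∈ O → z ω' ∈ U := by
    rintro ⟨ω, hω⟩
    obtain ⟨ε, hε, hball⟩ := Metric.isOpen_iff.1 hU (z ω) hω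
    have hst := argmin_stable hd hh hβ hA hR (hz ω) (half_pos hε)
    obtain ⟨O, hOs, hO, hmem⟩ := mem_nhds_iff.1 hst
    refine ⟨O, hO, hmem, fun ω' h' => hball ?_⟩
    rw [Metric.mem_ball, dist_eq_norm]
    exact (hOs h' (c ω') (z ω') (hz ω')).trans_lt (half_lt_self hε)
  choose O hO hmem hsub using key
  have hpre : z ⁻¹' U = (fun ω => (u ω, S ω)) ⁻¹' ⋃ ω, O ω := by
    ext ω
    simp only [Set.mem_preimage, Set.mem_iUnion]
    exact ⟨fun hω => ⟨⟨ω, hω⟩, hmem ⟨ω, hω⟩⟩, fun ⟨ω', hω'⟩ => hsub ω' ω hω'⟩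
  rw [hpre]
  exact (hu.prodMk hS) (isOpen_iUnion hO).measurableSet

/-- The iterates of the intermediate gradient method are adapted. -/
theorem measurable_iterates [FiniteDimensional ℝ E] [MeasurableSpace E] [BorelSpace E]
    {d : E → ℝ} (hd : IsProxFunction d) {Q : Set E} {h : E → ℝ} (hh : ConvexOn ℝ Q h)
    {α β B : ℕ → ℝ} {ρ L R : ℝ} (hc : IsAdmissible α β B ρ L) (hβ : ∀ i, 0 < β i) (hR : 0 < R)
    {Ω : Type*} {ℋ : ℕ → MeasurableSpace Ω} (hmono : Monotone ℋ) {n : ℕ}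
    {u : Ω → E} {γ : Ω → ℕ → StrongDual ℝ E} {x y z xhat w : Ω → ℕ → E}
    (hu : Measurable[ℋ 0] u) (hxu : ∀ ω, x ω 0 = u ω)
    (hr : ∀ ω, IsSIGMRun Q h α β B (fun v => d (R⁻¹ • (v - u ω))) n (γ ω) (x ω) (y ω) (z ω)
      (xhat ω) (w ω))
    (hγ : ∀ i ≤ n, Measurable[ℋ i] (fun ω => x ω i) → Measurable[ℋ (i + 1)] fun ω => γ ω i) :
    ∀ i ≤ n, Measurable[ℋ i] (fun ω => x ω i) ∧ Measurable[ℋ (i + 1)] (fun ω => y ω i) ∧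
      (i < n → Measurable[ℋ (i + 1)] fun ω => z ω i) := by
  have := secondCountable_strongDual (E := E)
  have := secondCountable_space (E := E)
  have hu' : ∀ i, Measurable[ℋ i] u := fun i => hu.mono (hmono (Nat.zero_le i)) le_rfl
  have hzm : ∀ i < n, (∀ l ≤ i, Measurable[ℋ (i + 1)] fun ω => γ ω l) →
      Measurable[ℋ (i + 1)] fun ω => z ω i := by
    intro i hi hγm
    refine measurable_argmin hd hh (hβ i)
      (Finset.sum_nonneg fun l _ => (hc.alpha_pos l).le) hR (hu' _) ?_
      (fun ω => (hr ω).z_argmin' hi)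
    refine Finset.measurable_fun_sum _ fun l hl => ?_
    exact (hγm l (by have := Finset.mem_range.1 hl; omega)).const_smul (α l)
  -- All earlier answers are carried along because `z i` depends on the whole sum of them.
  have main : ∀ i ≤ n, Measurable[ℋ i] (fun ω => x ω i) ∧
      Measurable[ℋ (i + 1)] (fun ω => y ω i) ∧
      ∀ l ≤ i, Measurable[ℋ (i + 1)] fun ω => γ ω l := by
    intro i
    induction i with
    | zero =>
      intro h0
      have hx : Measurable[ℋ 0] fun ω => x ω 0 := by simpa only [hxu] using hu
      have hg := hγ 0 h0 hx
      refine ⟨hx, ?_, fun l hl => by rw [Nat.le_zero.1 hl]; exact hg⟩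
      exact measurable_argmin hd hh (hβ 0) (hc.alpha_pos 0).le hR (hu' _)
        (hg.const_smul (α 0)) (fun ω => (hr ω).y_zero')
    | succ i ih =>
      intro hi
      obtain ⟨-, hy, hg⟩ := ih (by omega)
      have hz := hzm i hi hg
      have hx : Measurable[ℋ (i + 1)] fun ω => x ω (i + 1) := by
        simp only [fun ω => (hr ω).x_succ i hi]
        exact (hz.const_smul _).add (hy.const_smul _)
      have hle : ℋ (i + 1) ≤ ℋ (i + 1 + 1) := hmono (Nat.le_succ _)
      have hg' := hγ (i + 1) hi hx
      have hgrad : Measurable[ℋ (i + 1)]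
          fun ω => fderiv ℝ (fun v => d (R⁻¹ • (v - u ω))) (z ω i) := by
        simp only [fderiv_rescaled hd.differentiable]
        have h1 : Measurable[ℋ (i + 1)] fun ω => R⁻¹ • (z ω i - u ω) :=
          (hz.sub (hu' _)).const_smul R⁻¹
        have h2 : Measurable[ℋ (i + 1)] fun ω => fderiv ℝ d (R⁻¹ • (z ω i - u ω)) :=
          (measurable_fderiv ℝ d).comp h1
        exact h2.const_smul R⁻¹
      have hS : Measurable[ℋ (i + 1 + 1)] fun ω => α (i + 1) • γ ω (i + 1)
          - β i • fderiv ℝ (fun v => d (R⁻¹ • (v - u ω))) (z ω i) := by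
        have h1 : Measurable[ℋ (i + 1 + 1)] fun ω => α (i + 1) • γ ω (i + 1) :=
          hg'.const_smul (α (i + 1))
        have h2 : Measurable[ℋ (i + 1 + 1)]
            fun ω => β i • fderiv ℝ (fun v => d (R⁻¹ • (v - u ω))) (z ω i) :=
          (hgrad.mono hle le_rfl).const_smul (β i)
        exact h1.sub h2
      have hxh : Measurable[ℋ (i + 1 + 1)] fun ω => xhat ω (i + 1) :=
        measurable_argmin hd hh (hβ i) (hc.alpha_pos (i + 1)).le hR (hu' _) hS
          (fun ω => (hr ω).xhat_argmin' hi)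
      have hy' := hy.mono hle le_rfl
      refine ⟨hx, ?_, fun l hl => ?_⟩
      · simp only [fun ω => (hr ω).y_succ i hi, fun ω => (hr ω).w_succ i hi]
        exact (hy'.const_smul _).add
          (((hxh.const_smul _).add (hy'.const_smul _)).const_smul _)
      · rcases Nat.lt_or_ge l (i + 1) with hl' | hl'
        · exact (hg l (by omega)).mono hle le_rfl
        · obtain rfl : l = i + 1 := by omega
          exact hg'
  exact fun i hi => ⟨(main i hi).1, (main i hi).2.1, fun h' => hzm i h' (main i hi).2.2⟩

end ArgminMeasurable

/-! ### Joint laws of the samples and the past -/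

section Sampling

variable {E Ξ Ω Θ : Type*} [MeasurableSpace E] [MeasurableSpace Ξ] [MeasurableSpace Θ]

/-- Given the σ-algebra `m`, the variables `ζ j`, `j < M`, are independent with the law `ν x`. -/
def IsConditionalSample (m : MeasurableSpace Ω) [MeasurableSpace Ω] (P : Measure Ω)
    (ν : Kernel E Ξ) (x : Ω → E) (M : ℕ) (ζ : ℕ → Ω → Ξ) : Prop :=
  ∀ A : Set Ω, MeasurableSet[m] A → ∀ S : ℕ → Set Ξ, (∀ j, MeasurableSet (S j)) →
    P (A ∩ ⋂ j ∈ Finset.range M, ζ j ⁻¹' S j) =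
      ∫⁻ ω in A, ∏ j ∈ Finset.range M, ν (x ω) (S j) ∂P

namespace IsConditionalSample

variable {m mΩ : MeasurableSpace Ω} {P : Measure Ω} {ν : Kernel E Ξ} [IsMarkovKernel ν] {x : Ω → E} {M : ℕ} {ζ : ℕ → Ω → Ξ}

theorem measure_pair (hs : IsConditionalSample m P ν x M ζ) {j l : ℕ} (hj : j < M) (hl : l < M)
    (hjl : j ≠ l) {A : Set Ω} (hA : MeasurableSet[m] A) {S T : Set Ξ} (hS : MeasurableSet S)
    (hT : MeasurableSet T) :
    P (A ∩ (ζ j ⁻¹' S ∩ ζ l ⁻¹' T)) = ∫⁻ ω in A, ν (x ω) S * ν (x ω) T ∂P := by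
  classical
  have h := hs A hA (fun i => if i = j then S else if i = l then T else Set.univ) (fun i => by
    split_ifs <;> first | assumption | exact MeasurableSet.univ)
  have e1 : (⋂ i ∈ Finset.range M, ζ i ⁻¹' (if i = j then S else if i = l then T else Set.univ))
      = ζ j ⁻¹' S ∩ ζ l ⁻¹' T := by
    ext ω
    simp only [Set.mem_iInter, Set.mem_preimage, Set.mem_inter_iff, Finset.mem_range]
    constructor
    · intro H
      have h1 := H j hj
      have h2 := H l hl
      rw [if_pos rfl] at h1
      rw [if_neg hjl.symm, if_pos rfl] at h2
      exact ⟨h1, h2⟩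
    · rintro ⟨h1, h2⟩ i -
      split_ifs with hi hi'
      · rw [hi]; exact h1
      · rw [hi']; exact h2
      · trivial
  have e2 : ∀ ω, ∏ i ∈ Finset.range M, ν (x ω) (if i = j then S else if i = l then T else Set.univ)
      = ν (x ω) S * ν (x ω) T := by
    intro ω
    rw [← Finset.prod_subset (s₁ := {j, l})]
    · rw [Finset.prod_pair hjl, if_pos rfl, if_neg hjl.symm, if_pos rfl]
    · intro i hi
      simp only [Finset.mem_insert, Finset.mem_singleton] at hi
      rcases hi with rfl | rfl <;> simpa
    · intro i _ hi
      simp only [Finset.mem_insert, Finset.mem_singleton, not_or] at hi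
      simp [hi.1, hi.2]
  rw [e1] at h
  simpa only [e2] using h

theorem measure_single (hs : IsConditionalSample m P ν x M ζ) {j : ℕ} (hj : j < M)
    {A : Set Ω} (hA : MeasurableSet[m] A) {S : Set Ξ} (hS : MeasurableSet S) :
    P (A ∩ ζ j ⁻¹' S) = ∫⁻ ω in A, ν (x ω) S ∂P := by
  classical
  have h := hs A hA (fun i => if i = j then S else Set.univ) (fun i => by
    split_ifs <;> first | assumption | exact MeasurableSet.univ)
  have e1 : (⋂ i ∈ Finset.range M, ζ i ⁻¹' (if i = j then S else Set.univ)) = ζ j ⁻¹' S := by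
    ext ω
    simp only [Set.mem_iInter, Set.mem_preimage, Finset.mem_range]
    constructor
    · intro H
      have h1 := H j hj
      rwa [if_pos rfl] at h1
    · rintro h1 i -
      split_ifs with hi
      · rw [hi]; exact h1
      · trivial
  have e2 : ∀ ω, ∏ i ∈ Finset.range M, ν (x ω) (if i = j then S else Set.univ)
      = ν (x ω) S := by
    intro ω
    rw [Finset.prod_eq_single j]
    · rw [if_pos rfl]
    · intro i _ hi
      simp [hi]
    · intro h'
      exact absurd (Finset.mem_range.2 hj) h'
  rw [e1] at h
  simpa only [e2] using h

/-- `θ` may carry any information about the past that determines `x`, such as the query point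
together with a test vector. The conditional law of the sample is still `ν x`; it suffices to
compare the measures on rectangles. -/
theorem map_single [IsProbabilityMeasure P] (hs : IsConditionalSample m P ν x M ζ) (hm : m ≤ mΩ)
    (hζ : ∀ j, Measurable (ζ j)) {j : ℕ} (hj : j < M) {θ : Ω → Θ} (hθ : Measurable[m] θ)
    {q : Θ → E} (hq : Measurable q) (hqθ : ∀ ω, q (θ ω) = x ω) :
    P.map (fun ω => (θ ω, ζ j ω)) = P.map θ ⊗ₘ (ν.comap q hq) := by
  have hθ' : Measurable θ := hθ.mono hm le_rfl
  have hmeas : Measurable fun ω => (θ ω, ζ j ω) := hθ'.prodMk (hζ j)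
  have : IsProbabilityMeasure (P.map θ) := Measure.isProbabilityMeasure_map hθ'.aemeasurable
  have : IsFiniteMeasure (P.map fun ω => (θ ω, ζ j ω)) := by infer_instance
  refine Measure.ext_prod fun {s t} hs' ht => ?_
  rw [Measure.map_apply hmeas (hs'.prod ht), Measure.compProd_apply_prod hs' ht,
    setLIntegral_map hs' (Kernel.measurable_coe _ ht) hθ']
  have := hs.measure_single hj (hθ hs') ht
  simp only [Kernel.comap_apply, hqθ]
  rw [← this]
  rfl

theorem map_pair [IsProbabilityMeasure P] (hs : IsConditionalSample m P ν x M ζ) (hm : m ≤ mΩ)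
    (hζ : ∀ j, Measurable (ζ j)) (hx : Measurable[m] x) {j l : ℕ} (hj : j < M) (hl : l < M)
    (hjl : j ≠ l) :
    P.map (fun ω => (x ω, ζ j ω, ζ l ω)) = P.map x ⊗ₘ (ν ×ₖ ν) := by
  have hx' : Measurable x := hx.mono hm le_rfl
  have hmeas : Measurable fun ω => (x ω, ζ j ω, ζ l ω) := hx'.prodMk ((hζ j).prodMk (hζ l))
  have : IsProbabilityMeasure (P.map x) := Measure.isProbabilityMeasure_map hx'.aemeasurable
  have : IsFiniteMeasure (P.map fun ω => (x ω, ζ j ω, ζ l ω)) := by infer_instance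
  refine Measure.ext_prod₃ fun {s t v} hs' ht hv => ?_
  rw [Measure.map_apply hmeas (hs'.prod (ht.prod hv)),
    Measure.compProd_apply_prod hs' (ht.prod hv),
    setLIntegral_map hs' (Kernel.measurable_coe _ (ht.prod hv)) hx']
  simp only [Kernel.prod_apply_prod]
  rw [← hs.measure_pair hj hl hjl (hx hs') ht hv]
  rfl

end IsConditionalSample

end Sampling

/-! ### Mean and variance of the mini-batch noise -/

section Noise

variable {E : Type*} [NormedAddCommGroup E] [InnerProductSpace ℝ E]
  {Ω : Type*} {m mΩ : MeasurableSpace Ω} {P : Measure Ω}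

theorem integrable_inner_of_memLp {f g : Ω → E} (hf : MemLp f 2 P) (hg : MemLp g 2 P) :
    Integrable (fun ω => ⟪f ω, g ω⟫) P := by
  refine (hf.norm.integrable_mul hg.norm).mono (hf.1.inner hg.1) (ae_of_all _ fun ω => ?_)
  simpa using norm_inner_le_norm (𝕜 := ℝ) (f ω) (g ω)

/-- A measurable field of centred random vectors with variance at most `σ²`. -/
structure IsNoiseField [MeasurableSpace E] {Ξ : Type*} [MeasurableSpace Ξ] (ν : Kernel E Ξ)
    (Z : E → Ξ → E) (σ : ℝ) : Prop where
  measurable : Measurable fun q : E × Ξ => Z q.1 q.2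
  integrable : ∀ x, Integrable (Z x) (ν x)
  mean : ∀ x, ∫ s, Z x s ∂(ν x) = 0
  integrable_sq : ∀ x, Integrable (fun s => ‖Z x s‖ ^ 2) (ν x)
  sq_le : ∀ x, ∫ s, ‖Z x s‖ ^ 2 ∂(ν x) ≤ σ ^ 2

namespace IsNoiseField

variable [MeasurableSpace E] {Ξ : Type*} [MeasurableSpace Ξ] {ν : Kernel E Ξ} {Z : E → Ξ → E}
  {σ : ℝ} {x : Ω → E} {M : ℕ} {ζ : ℕ → Ω → Ξ}

theorem measurable_comp (hZ : IsNoiseField ν Z σ) (hm : m ≤ mΩ) (hζ : ∀ j, Measurable (ζ j))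
    (hx : Measurable[m] x) (j : ℕ) : Measurable fun ω => Z (x ω) (ζ j ω) :=
  hZ.measurable.comp ((hx.mono hm le_rfl).prodMk (hζ j))

variable [BorelSpace E] [IsMarkovKernel ν] [IsProbabilityMeasure P]

theorem integrable_and_sq_le (hZ : IsNoiseField ν Z σ) (hs : IsConditionalSample m P ν x M ζ)
    (hm : m ≤ mΩ) (hζ : ∀ j, Measurable (ζ j)) (hx : Measurable[m] x) {j : ℕ} (hj : j < M) :
    Integrable (fun ω => ‖Z (x ω) (ζ j ω)‖ ^ 2) P ∧
      ∫ ω, ‖Z (x ω) (ζ j ω)‖ ^ 2 ∂P ≤ σ ^ 2 := by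
  have hx' : Measurable x := hx.mono hm le_rfl
  have : IsProbabilityMeasure (P.map x) := Measure.isProbabilityMeasure_map hx'.aemeasurable
  have hmap := hs.map_single hm hζ hj hx measurable_id (fun _ => rfl)
  have hpair : Measurable fun ω => (x ω, ζ j ω) := hx'.prodMk (hζ j)
  have hF : Measurable fun q : E × Ξ => ‖Z q.1 q.2‖ ^ 2 := hZ.measurable.norm.pow_const 2
  have hbd : ∀ a, ∫ s, ‖‖Z a s‖ ^ 2‖ ∂(ν.comap id measurable_id a) ≤ σ ^ 2 := by
    intro a
    simpa using hZ.sq_le a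
  have hint₁ : Integrable (fun a => ∫ s, ‖‖Z a s‖ ^ 2‖ ∂(ν.comap id measurable_id a))
      (P.map x) := by
    refine Integrable.of_bound (C := σ ^ 2) ?_ (ae_of_all _ fun a => ?_)
    · exact (hF.stronglyMeasurable.norm.integral_kernel_prod_right').aestronglyMeasurable
    · rw [Real.norm_of_nonneg (integral_nonneg fun s => norm_nonneg _)]
      exact hbd a
  have hint : Integrable (fun q : E × Ξ => ‖Z q.1 q.2‖ ^ 2)
      (P.map x ⊗ₘ (ν.comap id measurable_id)) := by
    rw [Measure.integrable_compProd_iff hF.aestronglyMeasurable]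
    exact ⟨ae_of_all _ fun a => by simpa using hZ.integrable_sq a, hint₁⟩
  have hint' := hint
  rw [← hmap, integrable_map_measure hF.aestronglyMeasurable hpair.aemeasurable] at hint'
  refine ⟨hint', ?_⟩
  have e : ∫ ω, ‖Z (x ω) (ζ j ω)‖ ^ 2 ∂P
      = ∫ q, ‖Z q.1 q.2‖ ^ 2 ∂(P.map fun ω => (x ω, ζ j ω)) :=
    (integral_map hpair.aemeasurable hF.aestronglyMeasurable).symm
  rw [e, hmap, Measure.integral_compProd hint]
  calc _ ≤ ∫ _, σ ^ 2 ∂(P.map x) := by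
        refine integral_mono (by simpa using hint₁) (integrable_const _) fun a => ?_
        simpa using hZ.sq_le a
    _ = σ ^ 2 := by simp

variable [FiniteDimensional ℝ E]

theorem memLp (hZ : IsNoiseField ν Z σ) (hs : IsConditionalSample m P ν x M ζ)
    (hm : m ≤ mΩ) (hζ : ∀ j, Measurable (ζ j)) (hx : Measurable[m] x) {j : ℕ} (hj : j < M) :
    MemLp (fun ω => Z (x ω) (ζ j ω)) 2 P := by
  have := secondCountable_space (E := E)
  exact (memLp_two_iff_integrable_sq_norm
    (hZ.measurable_comp hm hζ hx j).aestronglyMeasurable).2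
    (hZ.integrable_and_sq_le hs hm hζ hx hj).1

/-- A test vector known from the past is frozen when the joint law is disintegrated, and the inner
integral is its product with the zero mean. -/
theorem integral_inner_eq_zero (hZ : IsNoiseField ν Z σ) (hs : IsConditionalSample m P ν x M ζ)
    (hm : m ≤ mΩ) (hζ : ∀ j, Measurable (ζ j)) (hx : Measurable[m] x) {j : ℕ} (hj : j < M)
    {v : Ω → E} (hv : Measurable[m] v) (hv2 : MemLp v 2 P) :
    ∫ ω, ⟪Z (x ω) (ζ j ω), v ω⟫ ∂P = 0 := by
  have := secondCountable_space (E := E)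
  have hθ : Measurable[m] fun ω => (x ω, v ω) := hx.prodMk hv
  have hθ' : Measurable fun ω => (x ω, v ω) := hθ.mono hm le_rfl
  have : IsProbabilityMeasure (P.map fun ω => (x ω, v ω)) :=
    Measure.isProbabilityMeasure_map hθ'.aemeasurable
  have hmap := hs.map_single hm hζ hj hθ measurable_fst (fun _ => rfl)
  have hpair : Measurable fun ω => ((x ω, v ω), ζ j ω) := hθ'.prodMk (hζ j)
  have hF : Measurable fun q : (E × E) × Ξ => ⟪Z q.1.1 q.2, q.1.2⟫ :=
    (hZ.measurable.comp (measurable_fst.fst.prodMk measurable_snd)).inner measurable_fst.snd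
  have e : ∫ ω, ⟪Z (x ω) (ζ j ω), v ω⟫ ∂P
      = ∫ q, ⟪Z q.1.1 q.2, q.1.2⟫ ∂(P.map fun ω => ((x ω, v ω), ζ j ω)) :=
    (integral_map hpair.aemeasurable hF.aestronglyMeasurable).symm
  have hint : Integrable (fun q : (E × E) × Ξ => ⟪Z q.1.1 q.2, q.1.2⟫)
      (P.map fun ω => ((x ω, v ω), ζ j ω)) := by
    rw [integrable_map_measure hF.aestronglyMeasurable hpair.aemeasurable]
    exact integrable_inner_of_memLp (hZ.memLp hs hm hζ hx hj) hv2
  rw [e, hmap]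
  rw [hmap] at hint
  rw [Measure.integral_compProd hint]
  refine integral_eq_zero_of_ae (ae_of_all _ fun a => ?_)
  simp only [Kernel.comap_apply, Pi.zero_apply]
  simp_rw [real_inner_comm a.2]
  rw [integral_inner (hZ.integrable a.1), hZ.mean, inner_zero_right]

theorem integral_inner_pair_eq_zero (hZ : IsNoiseField ν Z σ)
    (hs : IsConditionalSample m P ν x M ζ)
    (hm : m ≤ mΩ) (hζ : ∀ j, Measurable (ζ j)) (hx : Measurable[m] x) {j l : ℕ} (hj : j < M)
    (hl : l < M) (hjl : j ≠ l) :
    ∫ ω, ⟪Z (x ω) (ζ j ω), Z (x ω) (ζ l ω)⟫ ∂P = 0 := by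
  have := secondCountable_space (E := E)
  have hx' : Measurable x := hx.mono hm le_rfl
  have : IsProbabilityMeasure (P.map x) := Measure.isProbabilityMeasure_map hx'.aemeasurable
  have hmap := hs.map_pair hm hζ hx hj hl hjl
  have hpair : Measurable fun ω => (x ω, ζ j ω, ζ l ω) := hx'.prodMk ((hζ j).prodMk (hζ l))
  have hF : Measurable fun q : E × Ξ × Ξ => ⟪Z q.1 q.2.1, Z q.1 q.2.2⟫ :=
    (hZ.measurable.comp (measurable_fst.prodMk measurable_snd.fst)).inner
      (hZ.measurable.comp (measurable_fst.prodMk measurable_snd.snd))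
  have e : ∫ ω, ⟪Z (x ω) (ζ j ω), Z (x ω) (ζ l ω)⟫ ∂P
      = ∫ q, ⟪Z q.1 q.2.1, Z q.1 q.2.2⟫ ∂(P.map fun ω => (x ω, ζ j ω, ζ l ω)) :=
    (integral_map hpair.aemeasurable hF.aestronglyMeasurable).symm
  have hint : Integrable (fun q : E × Ξ × Ξ => ⟪Z q.1 q.2.1, Z q.1 q.2.2⟫)
      (P.map fun ω => (x ω, ζ j ω, ζ l ω)) := by
    rw [integrable_map_measure hF.aestronglyMeasurable hpair.aemeasurable]
    exact integrable_inner_of_memLp (hZ.memLp hs hm hζ hx hj) (hZ.memLp hs hm hζ hx hl)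
  rw [e, hmap]
  rw [hmap] at hint
  rw [Measure.integral_compProd hint]
  refine integral_eq_zero_of_ae (ae_of_all _ fun a => ?_)
  simp only [Kernel.prod_apply, Pi.zero_apply]
  -- On fibres where the product is not integrable the Bochner integral is `0` by convention, so
  -- both cases give the same value.
  by_cases hI : Integrable (fun b : Ξ × Ξ => ⟪Z a b.1, Z a b.2⟫) ((ν a).prod (ν a))
  · rw [integral_prod _ hI]
    refine integral_eq_zero_of_ae (ae_of_all _ fun s => ?_)
    simp only [Pi.zero_apply]
    rw [integral_inner (hZ.integrable a), hZ.mean, inner_zero_right]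
  · exact integral_undef hI

/-- The mean of a mini-batch of centred random vectors. -/
theorem batch_mean (hZ : IsNoiseField ν Z σ) (hs : IsConditionalSample m P ν x M ζ)
    (hM : 0 < M) (hm : m ≤ mΩ) (hζ : ∀ j, Measurable (ζ j)) (hx : Measurable[m] x) :
    MemLp (fun ω => (M : ℝ)⁻¹ • ∑ j ∈ Finset.range M, Z (x ω) (ζ j ω)) 2 P ∧
    ∫ ω, ‖(M : ℝ)⁻¹ • ∑ j ∈ Finset.range M, Z (x ω) (ζ j ω)‖ ^ 2 ∂P ≤ σ ^ 2 / M ∧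
    ∀ v : Ω → E, Measurable[m] v → MemLp v 2 P →
      ∫ ω, ⟪(M : ℝ)⁻¹ • ∑ j ∈ Finset.range M, Z (x ω) (ζ j ω), v ω⟫ ∂P = 0 := by
  have hM' : (0 : ℝ) < M := by exact_mod_cast hM
  have hmem : ∀ j ∈ Finset.range M, MemLp (fun ω => Z (x ω) (ζ j ω)) 2 P :=
    fun j hj => hZ.memLp hs hm hζ hx (Finset.mem_range.1 hj)
  refine ⟨(memLp_finsetSum _ hmem).const_smul _, ?_, fun v hv hv2 => ?_⟩
  · have e1 : ∀ ω, ‖(M : ℝ)⁻¹ • ∑ j ∈ Finset.range M, Z (x ω) (ζ j ω)‖ ^ 2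
        = (M : ℝ)⁻¹ ^ 2 * ∑ j ∈ Finset.range M, ∑ l ∈ Finset.range M,
          ⟪Z (x ω) (ζ j ω), Z (x ω) (ζ l ω)⟫ := by
      intro ω
      rw [norm_smul, mul_pow, Real.norm_eq_abs, sq_abs, ← real_inner_self_eq_norm_sq, sum_inner]
      simp only [inner_sum]
    simp only [e1]
    rw [integral_const_mul, integral_finsetSum]
    -- Distinct samples are uncorrelated, so only the diagonal of the double sum contributes; this
    -- gives the factor `1 / M`.
    · have e2 : ∀ j ∈ Finset.range M, ∫ ω, ∑ l ∈ Finset.range M,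
          ⟪Z (x ω) (ζ j ω), Z (x ω) (ζ l ω)⟫ ∂P ≤ σ ^ 2 := by
        intro j hj
        rw [integral_finsetSum _ fun l hl => integrable_inner_of_memLp (hmem j hj) (hmem l hl),
          Finset.sum_eq_single j]
        · simp only [real_inner_self_eq_norm_sq]
          exact (hZ.integrable_and_sq_le hs hm hζ hx (Finset.mem_range.1 hj)).2
        · intro l hl hlj
          exact hZ.integral_inner_pair_eq_zero hs hm hζ hx (Finset.mem_range.1 hj)
            (Finset.mem_range.1 hl) hlj.symm
        · exact fun h => absurd hj h
      calc _ ≤ (M : ℝ)⁻¹ ^ 2 * ∑ _j ∈ Finset.range M, σ ^ 2 := by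
            gcongr with j hj; exact e2 j hj
        _ = σ ^ 2 / M := by
            rw [Finset.sum_const, Finset.card_range, nsmul_eq_mul]; field_simp
    · intro j hj
      exact integrable_finsetSum _ fun l hl => integrable_inner_of_memLp (hmem j hj) (hmem l hl)
  · have e1 : ∀ ω, ⟪(M : ℝ)⁻¹ • ∑ j ∈ Finset.range M, Z (x ω) (ζ j ω), v ω⟫
        = (M : ℝ)⁻¹ * ∑ j ∈ Finset.range M, ⟪Z (x ω) (ζ j ω), v ω⟫ := by
      intro ω
      rw [real_inner_smul_left, sum_inner]
    simp only [e1]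
    rw [integral_const_mul, integral_finsetSum _ fun j hj =>
      integrable_inner_of_memLp (hmem j hj) hv2, Finset.sum_eq_zero, mul_zero]
    intro j hj
    exact hZ.integral_inner_eq_zero hs hm hζ hx (Finset.mem_range.1 hj) hv hv2

end IsNoiseField

end Noise

/-! ### Expected error of one outer iteration -/

section InnerIteration

variable {E : Type*} [NormedAddCommGroup E] [InnerProductSpace ℝ E]

/-- The Riesz representative of a functional. -/
def riesz [CompleteSpace E] (g : StrongDual ℝ E) : E := (InnerProductSpace.toDual ℝ E).symm g

theorem inner_riesz [CompleteSpace E] (g : StrongDual ℝ E) (v : E) : ⟪riesz g, v⟫ = g v :=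
  InnerProductSpace.toDual_symm_apply

theorem norm_riesz [CompleteSpace E] (g : StrongDual ℝ E) : ‖riesz g‖ = ‖g‖ :=
  LinearIsometryEquiv.norm_map _ g

theorem measurable_riesz [CompleteSpace E] [MeasurableSpace E] [BorelSpace E] :
    Measurable (riesz : StrongDual ℝ E → E) :=
  (InnerProductSpace.toDual ℝ E).symm.continuous.measurable

theorem riesz_ext [CompleteSpace E] {g : StrongDual ℝ E} {e : E} (h : ∀ v, ⟪e, v⟫ = g v) :
    riesz g = e :=
  ext_inner_right ℝ fun v => by rw [inner_riesz, h]

/-- A retraction of the measurable space onto `Q`. -/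
def retract {E : Type*} (Q : Set E) (xs : E) (x : E) : E :=
  haveI := Classical.propDecidable
  if x ∈ Q then x else xs

theorem retract_mem {E : Type*} {Q : Set E} {xs : E} (hxs : xs ∈ Q) (x : E) : retract Q xs x ∈ Q := by
  unfold retract
  split_ifs with h
  · exact h
  · exact hxs

theorem retract_of_mem {E : Type*} {Q : Set E} {xs x : E} (hx : x ∈ Q) : retract Q xs x = x := if_pos hx

theorem measurable_retract {E : Type*} [MeasurableSpace E] {Q : Set E} (hQ : MeasurableSet Q) (xs : E) :
    Measurable (retract Q xs) :=
  haveI := Classical.propDecidable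
  Measurable.ite hQ measurable_id measurable_const

/-- The noise of a stochastic oracle, extended to the whole space. -/
theorem IsStochasticOracle.isNoiseField [FiniteDimensional ℝ E] [CompleteSpace E]
    [MeasurableSpace E] [BorelSpace E]
    {Ξ : Type*} [MeasurableSpace Ξ] {Q : Set E} (hQ : IsClosed Q) {xs : E} (hxs : xs ∈ Q)
    {f : E → ℝ} {δ L σ : ℝ} {fδ : E → ℝ} {gδ : E → StrongDual ℝ E} {ν : Kernel E Ξ}
    [IsMarkovKernel ν] {F : E → Ξ → ℝ} {G : E → Ξ → StrongDual ℝ E}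
    (ho : IsStochasticOracle Q f δ L σ fδ gδ ν F G) :
    IsNoiseField (ν.comap (retract Q xs) (measurable_retract hQ.measurableSet xs))
      (fun x s => riesz (G (retract Q xs x) s - gδ (retract Q xs x))) σ := by
  have := secondCountable_space (E := E)
  have := secondCountable_strongDual (E := E)
  have hr := measurable_retract hQ.measurableSet xs
  have hmem := retract_mem hxs
  have hG : Measurable fun q : E × Ξ => G (retract Q xs q.1) q.2 :=
    ho.measurable_G.comp (((hr.comp measurable_fst).subtype_mk
      (h := fun q : E × Ξ => hmem q.1)).prodMk measurable_snd)
  -- The measurability of `gδ` on `Q` is inherited from `G`, of which it is the mean.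
  have hg : Measurable fun x => gδ (retract Q xs x) := by
    have h1 : StronglyMeasurable fun x => ∫ s, G (retract Q xs x) s ∂(ν.comap (retract Q xs) hr x) :=
      hG.stronglyMeasurable.integral_kernel_prod_right'
    have h2 : (fun x => ∫ s, G (retract Q xs x) s ∂(ν.comap (retract Q xs) hr x))
        = fun x => gδ (retract Q xs x) := by
      funext x
      exact ho.mean_G _ (hmem x)
    rw [← h2]
    exact h1.measurable
  have hZ : Measurable fun q : E × Ξ => riesz (G (retract Q xs q.1) q.2 - gδ (retract Q xs q.1)) :=
    measurable_riesz.comp (hG.sub (hg.comp measurable_fst))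
  have hint : ∀ x, Integrable (fun s => G (retract Q xs x) s - gδ (retract Q xs x))
      (ν (retract Q xs x)) := fun x =>
    (ho.integrable_G _ (hmem x)).sub (integrable_const _)
  have hintZ : ∀ x, Integrable (fun s => riesz (G (retract Q xs x) s - gδ (retract Q xs x)))
      (ν (retract Q xs x)) := fun x =>
    (hint x).mono (hZ.comp measurable_prodMk_left).aestronglyMeasurable
      (ae_of_all _ fun s => (norm_riesz _).le)
  refine ⟨hZ, hintZ, fun x => ?_, fun x => ?_, fun x => ?_⟩
  · refine ext_inner_left ℝ fun v => ?_
    rw [Kernel.comap_apply, ← integral_inner (hintZ x), inner_zero_right]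
    simp_rw [real_inner_comm _ v, inner_riesz]
    rw [← ContinuousLinearMap.integral_apply (hint x),
      integral_sub (ho.integrable_G _ (hmem x)) (integrable_const _), ho.mean_G _ (hmem x)]
    simp
  · simp only [norm_riesz]
    exact ho.integrable_noise _ (hmem x)
  · simp only [norm_riesz]
    exact ho.noise_le _ (hmem x)

/-- The expected error after the inner iterations. -/
theorem expected_gap_le [FiniteDimensional ℝ E] [MeasurableSpace E] [BorelSpace E]
    {Ξ : Type*} [MeasurableSpace Ξ] {Ω : Type*} [mΩ : MeasurableSpace Ω] {P : Measure Ω}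
    [IsProbabilityMeasure P] {Q : Set E} (hQ : IsClosed Q)
    {f h : E → ℝ} (hf : ConvexOn ℝ Q f) (hh : ConvexOn ℝ Q h)
    (hφm : Measurable fun x : Q => f x + h x) {xs : E} (hxs : IsArgmin (fun x => f x + h x) Q xs)
    {δ L σ : ℝ} {fδ : E → ℝ} {gδ : E → StrongDual ℝ E} {ν : Kernel E Ξ}
    [IsMarkovKernel ν] {F : E → Ξ → ℝ} {G : E → Ξ → StrongDual ℝ E}
    (ho : IsStochasticOracle Q f δ L σ fδ gδ ν F G)
    {d : E → ℝ} (hd : IsProxFunction d) {V : ℝ} (hdV : HasProxMomentBound d V)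
    {R : ℝ} (hR : 0 < R) {α β B : ℕ → ℝ} (hc : IsAdmissible α β B (R ^ 2)⁻¹ L)
    (hβ : ∀ i, 0 < β i) (hβσ : ∀ i, (R ^ 2)⁻¹ * β i - L = 0 → σ = 0)
    {ℋ : ℕ → MeasurableSpace Ω} (hmono : Monotone ℋ) (hle : ∀ i, ℋ i ≤ mΩ) {n M : ℕ} (hM : 0 < M)
    {u : Ω → E} (hu : Measurable[ℋ 0] u) (hu2 : Integrable (fun ω => ‖u ω - xs‖ ^ 2) P)
    (huR : ∫ ω, ‖u ω - xs‖ ^ 2 ∂P ≤ R ^ 2)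
    {ζ : ℕ → ℕ → Ω → Ξ} (hζ : ∀ i j, Measurable (ζ i j))
    (hζℋ : ∀ i ≤ n, ∀ j < M, Measurable[ℋ (i + 1)] (ζ i j))
    {x y z xhat w : Ω → ℕ → E} (hxu : ∀ ω, x ω 0 = u ω)
    (hs : ∀ i ≤ n, IsConditionalSample (ℋ i) P ν (fun ω => x ω i) M (ζ i))
    (hr : ∀ ω, IsSIGMRun Q h α β B (fun v => d (R⁻¹ • (v - u ω))) n
      (fun i => (M : ℝ)⁻¹ • ∑ j ∈ Finset.range M, G (x ω i) (ζ i j ω)) (x ω) (y ω) (z ω)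
      (xhat ω) (w ω)) :
    Measurable[ℋ (n + 1)] (fun ω => y ω n) ∧ Integrable (fun ω => f (y ω n) + h (y ω n)) P ∧
      (∑ l ∈ Finset.range (n + 1), α l) * (∫ ω, (f (y ω n) + h (y ω n)) ∂P - (f xs + h xs)) ≤
        β n * (V ^ 2 / 2) + ∑ l ∈ Finset.range (n + 1),
          B l * (δ + σ ^ 2 / M / (2 * ((R ^ 2)⁻¹ * β (l - 1) - L))) := by
  have := secondCountable_space (E := E)
  have := secondCountable_strongDual (E := E)
  have : CompleteSpace E := FiniteDimensional.complete ℝ E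
  have hM' : (0 : ℝ) < M := by exact_mod_cast hM
  have hxQ : ∀ i ≤ n, ∀ ω, x ω i ∈ Q := fun i hi ω => ((hr ω).mem hf.1 hc i hi).1
  have hyQ : ∀ i ≤ n, ∀ ω, y ω i ∈ Q := fun i hi ω => ((hr ω).mem hf.1 hc i hi).2
  have hmeas := measurable_iterates hd hh hc hβ hR hmono hu hxu hr (fun i hi hx => by
    have hsum : Measurable[ℋ (i + 1)]
        fun ω => ∑ j ∈ Finset.range M, G (x ω i) (ζ i j ω) := by
      refine Finset.measurable_fun_sum _ fun j hj => ?_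
      exact ho.measurable_G.comp (((hx.mono (hmono (Nat.le_succ i)) le_rfl).subtype_mk
        (h := hxQ i hi)).prodMk (hζℋ i hi j (Finset.mem_range.1 hj)))
    exact hsum.const_smul (M : ℝ)⁻¹)
  -- the noise of the mini-batches
  set Z : E → Ξ → E := fun x s => riesz (G (retract Q xs x) s - gδ (retract Q xs x)) with hZdef
  have hZ := ho.isNoiseField hQ hxs.1
  set e : Ω → ℕ → E := fun ω i => (M : ℝ)⁻¹ • ∑ j ∈ Finset.range M, Z (x ω i) (ζ i j ω) with he
  set γ : Ω → ℕ → StrongDual ℝ E :=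
    fun ω i => (M : ℝ)⁻¹ • ∑ j ∈ Finset.range M, G (x ω i) (ζ i j ω) with hγ
  have hinner : ∀ i ≤ n, ∀ ω v, (γ ω i - gδ (x ω i)) v = ⟪e ω i, v⟫ := by
    intro i hi ω v
    simp only [he, hγ, hZdef, retract_of_mem (hxQ i hi ω), real_inner_smul_left, sum_inner,
      inner_riesz, sub_apply, smul_apply, sum_apply, Finset.sum_sub_distrib, Finset.sum_const,
      Finset.card_range, nsmul_eq_mul, smul_eq_mul]
    field_simp
  have hnorm : ∀ i ≤ n, ∀ ω, ‖γ ω i - gδ (x ω i)‖ = ‖e ω i‖ := by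
    intro i hi ω
    rw [← norm_riesz, riesz_ext fun v => (hinner i hi ω v).symm]
  have hs' : ∀ i ≤ n, IsConditionalSample (ℋ i) P
      (ν.comap (retract Q xs) (measurable_retract hQ.measurableSet xs)) (fun ω => x ω i) M
      (ζ i) := by
    intro i hi A hA S hS
    rw [hs i hi A hA S hS]
    simp only [Kernel.comap_apply, retract_of_mem (hxQ i hi _)]
  have hbatch := fun i (hi : i ≤ n) => hZ.batch_mean (hs' i hi) hM (hle i) (hζ i) (hmeas i hi).1
  have he2 : ∀ i ≤ n, MemLp (fun ω => e ω i) 2 P := fun i hi => (hbatch i hi).1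
  have hesq : ∀ i ≤ n, ∫ ω, ‖e ω i‖ ^ 2 ∂P ≤ σ ^ 2 / M := fun i hi => (hbatch i hi).2.1
  have hesqi : ∀ i ≤ n, Integrable (fun ω => ‖e ω i‖ ^ 2) P := fun i hi =>
    (memLp_two_iff_integrable_sq_norm (he2 i hi).1).1 (he2 i hi)
  -- If the surplus of `β` vanishes then `σ = 0`, and the noise is zero only almost surely; hence
  -- the pathwise estimate holds almost everywhere.
  have hdeg : ∀ᵐ ω ∂P, ∀ l ≤ n, (R ^ 2)⁻¹ * β (l - 1) - L = 0 → γ ω l - gδ (x ω l) = 0 := by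
    rw [ae_all_iff]
    intro l
    by_cases hl : l ≤ n
    · by_cases h0 : (R ^ 2)⁻¹ * β (l - 1) - L = 0
      · have h1 : ∫ ω, ‖e ω l‖ ^ 2 ∂P = 0 := by
          refine le_antisymm ?_ (integral_nonneg fun ω => by positivity)
          simpa [hβσ _ h0] using hesq l hl
        rw [integral_eq_zero_iff_of_nonneg (fun ω => by positivity) (hesqi l hl)] at h1
        filter_upwards [h1] with ω hω _ _
        rw [← norm_eq_zero, hnorm l hl]
        simpa using hω
      · exact ae_of_all _ fun ω _ h => absurd h h0
    · exact ae_of_all _ fun ω h => absurd h hl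
  -- the right-hand side of the pathwise estimate
  set rhs : ℕ → Ω → ℝ := fun i ω => β i * d (R⁻¹ • (xs - u ω))
    + ∑ l ∈ Finset.range (i + 1), B l * (δ + ‖e ω l‖ ^ 2 / (2 * ((R ^ 2)⁻¹ * β (l - 1) - L)))
    + ∑ l ∈ Finset.range (i + 1), α l * ⟪e ω l, xs - prevPoint (x ω) (z ω) l⟫ with hrhs
  have hpath : ∀ᵐ ω ∂P, ∀ i ≤ n,
      (∑ l ∈ Finset.range (i + 1), α l) * (f (y ω i) + h (y ω i) - (f xs + h xs))
        + (if i < n then β i * ((R ^ 2)⁻¹ / 2 * ‖xs - z ω i‖ ^ 2) else 0) ≤ rhs i ω := by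
    filter_upwards [hdeg] with ω hω i hi
    have hgap := (hr ω).gap_le hf hh ho.inexact hc (differentiable_rescaled hd.differentiable _ _)
      (hd.le_bregman_rescaled _ _) (by simp [hxu, hd.map_zero]) (fun v => hd.nonneg _) hω hxs i hi
    refine hgap.trans (le_of_eq ?_)
    have h1 : ∀ l ∈ Finset.range (i + 1), l ≤ n := fun l hl => by
      have := Finset.mem_range.1 hl; omega
    simp only [hrhs]
    congr 1
    · congr 1
      exact Finset.sum_congr rfl fun l hl => by rw [hnorm l (h1 l hl)]
    · exact Finset.sum_congr rfl fun l hl => by rw [hinner l (h1 l hl)]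
  have hgap0 : ∀ i ≤ n, ∀ ω,
      0 ≤ (∑ l ∈ Finset.range (i + 1), α l) * (f (y ω i) + h (y ω i) - (f xs + h xs)) := by
    intro i hi ω
    have h1 : f xs + h xs ≤ f (y ω i) + h (y ω i) := hxs.2 (hyQ i hi ω)
    exact mul_nonneg (Finset.sum_nonneg fun l _ => (hc.alpha_pos l).le) (by linarith)
  have hum : Measurable u := hu.mono (hle 0) le_rfl
  have hprev : ∀ l ≤ n, Measurable[ℋ l] fun ω => xs - prevPoint (x ω) (z ω) l := by
    intro l hl
    cases l with
    | zero => exact (hmeas 0 hl).1.const_sub xs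
    | succ l => exact ((hmeas l (by omega)).2.2 hl).const_sub xs
  -- the prox-term
  have hprox : Integrable (fun ω => d (R⁻¹ • (xs - u ω))) P ∧
      ∫ ω, d (R⁻¹ • (xs - u ω)) ∂P ≤ V ^ 2 / 2 := by
    have : IsProbabilityMeasure (P.map u) := Measure.isProbabilityMeasure_map hum.aemeasurable
    have hdc : Continuous d := hd.differentiable.continuous
    have hc1 : Continuous fun v : E => ‖xs - v‖ ^ 2 := by fun_prop
    have hc2 : Continuous fun v : E => d (R⁻¹ • (xs - v)) := by fun_prop
    have h1 := hdV (P.map u) xs R hR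
    rw [integrable_map_measure hc1.aestronglyMeasurable hum.aemeasurable,
      integrable_map_measure hc2.aestronglyMeasurable hum.aemeasurable,
      integral_map hum.aemeasurable hc1.aestronglyMeasurable,
      integral_map hum.aemeasurable hc2.aestronglyMeasurable] at h1
    simp only [norm_sub_rev xs] at h1
    exact h1 hu2 huR
  have hvar : ∀ i ≤ n, Integrable (fun ω => ∑ l ∈ Finset.range (i + 1),
      B l * (δ + ‖e ω l‖ ^ 2 / (2 * ((R ^ 2)⁻¹ * β (l - 1) - L)))) P := by
    intro i hi
    refine integrable_finsetSum _ fun l hl => Integrable.const_mul ?_ _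
    have hl' : l ≤ n := by have := Finset.mem_range.1 hl; omega
    exact (integrable_const δ).add ((hesqi l hl').div_const _)
  have hcross : ∀ i ≤ n, (∀ l ≤ i, MemLp (fun ω => xs - prevPoint (x ω) (z ω) l) 2 P) →
      ∀ l ∈ Finset.range (i + 1),
        Integrable (fun ω => α l * ⟪e ω l, xs - prevPoint (x ω) (z ω) l⟫) P := by
    intro i hi hmem l hl
    have hl' : l ≤ i := by have := Finset.mem_range.1 hl; omega
    exact (integrable_inner_of_memLp (he2 l (hl'.trans hi)) (hmem l hl')).const_mul _
  have hrhsi : ∀ i ≤ n, (∀ l ≤ i, MemLp (fun ω => xs - prevPoint (x ω) (z ω) l) 2 P) →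
      Integrable (rhs i) P := fun i hi hmem =>
    ((hprox.1.const_mul _).add (hvar i hi)).add (integrable_finsetSum _ (hcross i hi hmem))
  -- The right side at index `i` involves only the auxiliary points with index at most `i`, and the
  -- estimate bounds `‖xs - z i‖²` by that integrable function; so square integrability passes to
  -- index `i + 1`.
  have hmem : ∀ i ≤ n, ∀ l ≤ i, MemLp (fun ω => xs - prevPoint (x ω) (z ω) l) 2 P := by
    intro i
    induction i with
    | zero =>
      intro _ l hl
      obtain rfl := Nat.le_zero.1 hl
      rw [memLp_two_iff_integrable_sq_norm
        ((hprev 0 (Nat.zero_le n)).mono (hle 0) le_rfl).aestronglyMeasurable]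
      simpa [prevPoint, hxu, norm_sub_rev xs] using hu2
    | succ i ih =>
      intro hi l hl
      have hin : i < n := hi
      rcases Nat.lt_or_ge l (i + 1) with hl' | hl'
      · exact ih hin.le l (by omega)
      obtain rfl : l = i + 1 := by omega
      have hm : AEStronglyMeasurable (fun ω => xs - prevPoint (x ω) (z ω) (i + 1)) P :=
        ((hprev (i + 1) hi).mono (hle _) le_rfl).aestronglyMeasurable
      rw [memLp_two_iff_integrable_sq_norm hm]
      have hk : 0 < β i * ((R ^ 2)⁻¹ / 2) := by have := hβ i; positivity
      refine ((hrhsi i hin.le (ih hin.le)).const_mul (β i * ((R ^ 2)⁻¹ / 2))⁻¹).mono'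
        (hm.norm.pow 2) ?_
      filter_upwards [hpath] with ω hω
      have h1 := hω i hin.le
      rw [if_pos hin] at h1
      have h2 := hgap0 i hin.le ω
      rw [Real.norm_of_nonneg (by positivity), inv_mul_eq_div, le_div_iff₀ hk]
      simp only [prevPoint]
      linarith
  have hrhsn := hrhsi n le_rfl (hmem n le_rfl)
  have hym := (hmeas n le_rfl).2.1
  have hA : 0 < ∑ l ∈ Finset.range (n + 1), α l :=
    Finset.sum_pos (fun l _ => hc.alpha_pos l) ⟨0, by simp⟩
  have hφy : Measurable fun ω => f (y ω n) + h (y ω n) :=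
    hφm.comp ((hym.mono (hle _) le_rfl).subtype_mk (h := hyQ n le_rfl))
  have hpathn : ∀ᵐ ω ∂P, (∑ l ∈ Finset.range (n + 1), α l)
      * (f (y ω n) + h (y ω n) - (f xs + h xs)) ≤ rhs n ω := by
    filter_upwards [hpath] with ω hω
    simpa using hω n le_rfl
  have hgi : Integrable (fun ω => (∑ l ∈ Finset.range (n + 1), α l)
      * (f (y ω n) + h (y ω n) - (f xs + h xs))) P := by
    refine hrhsn.mono' ((hφy.sub_const _).const_mul _).aestronglyMeasurable ?_
    filter_upwards [hpathn] with ω hω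
    rwa [Real.norm_of_nonneg (hgap0 n le_rfl ω)]
  have hφi : Integrable (fun ω => f (y ω n) + h (y ω n)) P := by
    have h1 := (hgi.const_mul (∑ l ∈ Finset.range (n + 1), α l)⁻¹).add
      (integrable_const (f xs + h xs))
    refine h1.congr (ae_of_all _ fun ω => ?_)
    simp only [Pi.add_apply]
    rw [inv_mul_cancel_left₀ hA.ne']
    ring
  refine ⟨hym, hφi, ?_⟩
  have h1 : ∫ ω, (∑ l ∈ Finset.range (n + 1), α l)
      * (f (y ω n) + h (y ω n) - (f xs + h xs)) ∂P
      = (∑ l ∈ Finset.range (n + 1), α l)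
        * (∫ ω, (f (y ω n) + h (y ω n)) ∂P - (f xs + h xs)) := by
    rw [integral_const_mul, integral_sub hφi (integrable_const _)]
    simp
  rw [← h1]
  refine (integral_mono_ae hgi hrhsn hpathn).trans ?_
  have h2 : ∫ ω, rhs n ω ∂P = β n * ∫ ω, d (R⁻¹ • (xs - u ω)) ∂P
      + ∑ l ∈ Finset.range (n + 1),
        B l * (δ + (∫ ω, ‖e ω l‖ ^ 2 ∂P) / (2 * ((R ^ 2)⁻¹ * β (l - 1) - L))) := by
    -- The point paired with the `l`-th noise is measurable with respect to `ℋ l`, hence known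
    -- before that mini-batch is drawn.
    have h3 : ∫ ω, ∑ l ∈ Finset.range (n + 1),
        α l * ⟪e ω l, xs - prevPoint (x ω) (z ω) l⟫ ∂P = 0 := by
      rw [integral_finsetSum _ (hcross n le_rfl (hmem n le_rfl))]
      refine Finset.sum_eq_zero fun l hl => ?_
      have hl' : l ≤ n := by have := Finset.mem_range.1 hl; omega
      rw [integral_const_mul, (hbatch l hl').2.2 _ (hprev l hl') (hmem n le_rfl l hl'), mul_zero]
    have h4 : ∫ ω, ∑ l ∈ Finset.range (n + 1),
        B l * (δ + ‖e ω l‖ ^ 2 / (2 * ((R ^ 2)⁻¹ * β (l - 1) - L))) ∂P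
        = ∑ l ∈ Finset.range (n + 1),
          B l * (δ + (∫ ω, ‖e ω l‖ ^ 2 ∂P) / (2 * ((R ^ 2)⁻¹ * β (l - 1) - L))) := by
      have hi : ∀ l ∈ Finset.range (n + 1), Integrable
          (fun ω => δ + ‖e ω l‖ ^ 2 / (2 * ((R ^ 2)⁻¹ * β (l - 1) - L))) P := fun l hl =>
        (integrable_const δ).add ((hesqi l (by
          have := Finset.mem_range.1 hl; omega)).div_const _)
      rw [integral_finsetSum _ fun l hl => (hi l hl).const_mul _]
      refine Finset.sum_congr rfl fun l hl => ?_
      have hl' : l ≤ n := by have := Finset.mem_range.1 hl; omega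
      rw [integral_const_mul, integral_add (integrable_const δ) ((hesqi l hl').div_const _),
        integral_div]
      simp
    have h5 := hprox.1.const_mul (β n)
    have h6 : Integrable (fun ω => β n * d (R⁻¹ • (xs - u ω)) + ∑ l ∈ Finset.range (n + 1),
        B l * (δ + ‖e ω l‖ ^ 2 / (2 * ((R ^ 2)⁻¹ * β (l - 1) - L)))) P := h5.add (hvar n le_rfl)
    simp only [hrhs]
    rw [integral_add h6
      (integrable_finsetSum _ (hcross n le_rfl (hmem n le_rfl))), h3, add_zero,
      integral_add h5 (hvar n le_rfl), integral_const_mul, h4]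
  rw [h2]
  refine add_le_add (mul_le_mul_of_nonneg_left hprox.2 (hβ n).le)
    (Finset.sum_le_sum fun l hl => ?_)
  have hl' : l ≤ n := by have := Finset.mem_range.1 hl; omega
  have hB : 0 ≤ B l := (hc.alpha_pos l).le.trans (hc.alpha_le l)
  have hcl := hc.le_beta (l - 1)
  have := hesq l hl'
  gcongr

end InnerIteration

/-! ### Error constants, contraction of the radius, and call counts -/

section Rates

/-- The error of `n` steps of the intermediate gradient method in terms of its constants. -/
theorem error_le {p : ℝ} (hp : 1 ≤ p) (hp2 : p ≤ 2) {L R s V δ : ℝ} (hL : 0 < L) (hR : 0 < R)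
    (hs : 0 ≤ s) (hV : 0 < V) {n : ℕ} (hn : 0 < n) :
    betaSeq p (L * R ^ 2) (s * R) V n * (V ^ 2 / 2)
      + ∑ l ∈ Finset.range (n + 1), bSeq p l
        * (δ + s ^ 2 / (2 * ((R ^ 2)⁻¹ * betaSeq p (L * R ^ 2) (s * R) V (l - 1) - L)))
      ≤ (∑ l ∈ Finset.range (n + 1), alphaSeq p l)
          * (C₁ * L * R ^ 2 * V ^ 2 / n ^ p + C₂ * s * R * V / √n)
        + δ * ∑ l ∈ Finset.range (n + 1), bSeq p l := by
  have hn' : (0 : ℝ) < n := by exact_mod_cast hn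
  have hsq : 0 < √(n : ℝ) := Real.sqrt_pos.2 hn'
  have hnp : 0 < (n : ℝ) ^ p := by positivity
  have hnc := noiseCoeff_pos hp
  set A := ∑ l ∈ Finset.range (n + 1), alphaSeq p l
  have e1 : betaSeq p (L * R ^ 2) (s * R) V n * (V ^ 2 / 2)
      = L * R ^ 2 * V ^ 2 / 2
        + s * R * V * (noiseCoeff p / 2 * (n + p + 1) ^ ((2 * p - 1) / 2)) := by
    unfold betaSeq noiseCoeff
    field_simp
  have e2 : ∑ l ∈ Finset.range (n + 1), bSeq p l
        * (δ + s ^ 2 / (2 * ((R ^ 2)⁻¹ * betaSeq p (L * R ^ 2) (s * R) V (l - 1) - L)))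
      = δ * ∑ l ∈ Finset.range (n + 1), bSeq p l
        + s * R * V * ∑ l ∈ Finset.range (n + 1), bSeq p l
        / (2 * noiseCoeff p * (((l - 1 : ℕ) : ℝ) + p + 1) ^ ((2 * p - 1) / 2)) := by
    rw [Finset.mul_sum, Finset.mul_sum, ← Finset.sum_add_distrib]
    refine Finset.sum_congr rfl fun l _ => ?_
    rw [betaSeq_sub hR]
    have hX : 0 < (((l - 1 : ℕ) : ℝ) + p + 1) ^ ((2 * p - 1) / 2) := by positivity
    -- Without noise the denominator is zero, and so is the quotient by convention.
    rcases hs.eq_or_lt with rfl | hs'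
    · simp [mul_comm]
    · field_simp
  have h1 : L * R ^ 2 * V ^ 2 / 2 ≤ A * (C₁ * L * R ^ 2 * V ^ 2 / n ^ p) := by
    rw [← mul_div_assoc, le_div_iff₀ hnp]
    have := mul_le_mul_of_nonneg_left (rpow_le_sum_alphaSeq hp hp2 n)
      (show 0 ≤ L * R ^ 2 * V ^ 2 / 2 by positivity)
    linarith
  have h2 := (le_div_iff₀ hsq).2 (noise_beta_le hp hp2 n)
  have h3 := (le_div_iff₀ hsq).2 (noise_variance_le hp hp2 n)
  have h4 := mul_le_mul_of_nonneg_left (add_le_add h2 h3)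
    (show 0 ≤ s * R * V by positivity)
  have e3 : s * R * V * (C₂ / 2 * A / √n + C₂ / 2 * A / √n) = A * (C₂ * s * R * V / √n) := by
    ring
  rw [e1, e2]
  rw [e3, mul_add] at h4
  linarith

namespace Params

variable {π : Params}

theorem kappa_pos (hL : 0 < π.L) (hμ : 0 < π.μ) (hV : 0 < π.V) : 0 < π.kappa := by
  unfold kappa C₁
  positivity

theorem innerSteps_pos (hL : 0 < π.L) (hμ : 0 < π.μ) (hV : 0 < π.V) : 0 < π.innerSteps :=
  Nat.ceil_pos.2 (Real.rpow_pos_of_pos (kappa_pos hL hμ hV) _)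

theorem batchSize_pos (π : Params) (k : ℕ) : 0 < π.batchSize k :=
  lt_of_lt_of_le one_pos (le_max_left _ _)

theorem exp_sub_one_pos : 0 < Real.exp 1 - 1 := by
  have := Real.add_one_lt_exp (one_ne_zero (α := ℝ))
  linarith

/-- The mini-batch size is defined with `R₀² e^{-k}` in place of `R_k²`; this comparison makes it
sufficient for the larger radius. -/
theorem le_radiusSq (hδ : 0 ≤ π.δ) (hL : 0 < π.L) (hμ : 0 < π.μ) (hV : 0 < π.V) (k : ℕ) :
    π.R₀ ^ 2 * Real.exp (-k) ≤ π.radiusSq k := by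
  have h1 := exp_sub_one_pos
  have h2 := kappa_pos hL hμ hV
  have h3 : 0 ≤ 1 - Real.exp (-(k : ℝ)) := by
    have : Real.exp (-(k : ℝ)) ≤ 1 := Real.exp_le_one_iff.2 (by simp)
    linarith
  unfold radiusSq C₃
  have : 0 ≤ (2 : ℝ) ^ π.p * Real.exp 1 * 48 * π.δ / (π.μ * (Real.exp 1 - 1))
      * π.kappa ^ ((π.p - 1) / π.p) * (1 - Real.exp (-k)) := by positivity
  linarith

theorem radiusSq_pos (hδ : 0 ≤ π.δ) (hL : 0 < π.L) (hμ : 0 < π.μ) (hV : 0 < π.V)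
    (hR₀ : 0 < π.R₀) (k : ℕ) : 0 < π.radiusSq k :=
  lt_of_lt_of_le (by positivity) (le_radiusSq hδ hL hμ hV k)

theorem radiusSq_zero (π : Params) : π.radiusSq 0 = π.R₀ ^ 2 := by simp [radiusSq]

/-- `R_k²` solves the recursion `R_{k+1}² = R_k² / e + c`; its `δ`-part tends to the fixed point `c
e / (e - 1)`. The coefficient `μ / (2e)` is split evenly between the deterministic and the
stochastic error. -/
theorem radiusSq_succ (hμ : 0 < π.μ) (k : ℕ) :
    π.μ / 2 * π.radiusSq (k + 1) = π.μ / (2 * Real.exp 1) * π.radiusSq k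
      + (2 : ℝ) ^ π.p / 2 * C₃ * π.kappa ^ ((π.p - 1) / π.p) * π.δ := by
  have h1 := exp_sub_one_pos
  have h2 : Real.exp (-((k + 1 : ℕ) : ℝ)) = Real.exp (-k) / Real.exp 1 := by
    rw [← Real.exp_sub]; congr 1; push_cast; ring
  have h3 := Real.exp_pos 1
  unfold radiusSq
  rw [h2]
  field_simp
  ring

theorem radius_sq (hδ : 0 ≤ π.δ) (hL : 0 < π.L) (hμ : 0 < π.μ) (hV : 0 < π.V)
    (hR₀ : 0 < π.R₀) (k : ℕ) : π.radius k ^ 2 = π.radiusSq k :=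
  Real.sq_sqrt (radiusSq_pos hδ hL hμ hV hR₀ k).le

/-- The mini-batches make the stochastic error small in comparison with the radius. -/
theorem noise_le (hδ : 0 ≤ π.δ) (hL : 0 < π.L) (hμ : 0 < π.μ) (hV : 0 < π.V)
    (hR₀ : 0 < π.R₀) (k : ℕ) :
    C₂ * (π.σ / √(π.batchSize k)) * π.radius k * π.V / √π.innerSteps
      ≤ π.μ / (4 * Real.exp 1) * π.radiusSq k := by
  have hN : (0 : ℝ) < π.innerSteps := by exact_mod_cast innerSteps_pos hL hμ hV
  have hm : (0 : ℝ) < π.batchSize k := by exact_mod_cast batchSize_pos π k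
  have hR : 0 < π.radius k := Real.sqrt_pos.2 (radiusSq_pos hδ hL hμ hV hR₀ k)
  have hsq := radius_sq hδ hL hμ hV hR₀ k
  have he := Real.exp_pos 1
  have hC : 0 < C₂ := by unfold C₂; positivity
  have hek : Real.exp (k + 2) = Real.exp 1 ^ 2 / Real.exp (-k) := by
    rw [← Real.exp_nat_mul, ← Real.exp_sub]; congr 1; push_cast; ring
  have hek' := Real.exp_pos (-(k : ℝ))
  have hceil : 16 * Real.exp (k + 2) * C₂ ^ 2 * π.σ ^ 2 * π.V ^ 2
      / (π.μ ^ 2 * π.R₀ ^ 2 * π.innerSteps) ≤ π.batchSize k := by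
    refine (Nat.le_ceil _).trans ?_
    unfold batchSize
    exact Nat.cast_le.2 (le_max_right _ _)
  rw [hek, div_le_iff₀ (by positivity)] at hceil
  have h1 : (C₂ * (π.σ / √(π.batchSize k)) * π.V / √π.innerSteps) ^ 2
      ≤ (π.μ / (4 * Real.exp 1) * π.radius k) ^ 2 := by
    have h2 : (C₂ * (π.σ / √(π.batchSize k)) * π.V / √π.innerSteps) ^ 2
        = C₂ ^ 2 * π.σ ^ 2 * π.V ^ 2 / (π.batchSize k * π.innerSteps) := by
      simp only [div_pow, mul_pow, Real.sq_sqrt hm.le, Real.sq_sqrt hN.le]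
      field_simp
    have h3 := le_radiusSq hδ hL hμ hV k
    rw [h2, mul_pow, hsq]
    refine le_trans ?_ (mul_le_mul_of_nonneg_left h3 (by positivity))
    rw [div_le_iff₀ (by positivity)]
    have h4 := mul_le_mul_of_nonneg_left hceil
      (show 0 ≤ Real.exp (-(k : ℝ)) / (16 * Real.exp 1 ^ 2) by positivity)
    refine le_trans (le_of_eq ?_) (h4.trans (le_of_eq ?_))
    · field_simp
    · field_simp
      ring
  have h5 := abs_le_of_sq_le_sq h1 (by positivity)
  have h6 := mul_le_mul_of_nonneg_right ((le_abs_self _).trans h5) hR.le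
  rw [← hsq]
  refine le_trans (le_of_eq ?_) (h6.trans (le_of_eq ?_)) <;> ring

theorem beta_eq (π : Params) (k : ℕ) :
    π.beta k = betaSeq π.p (π.L * π.radius k ^ 2)
      (π.σ / √(π.batchSize k) * π.radius k) π.V := by
  unfold beta
  rw [div_mul_eq_mul_div]

/-- The error of the inner iterations contracts the radius. -/
theorem inner_error_le (hp₁ : 1 ≤ π.p) (hp₂ : π.p ≤ 2) (hδ : 0 ≤ π.δ) (hσ : 0 ≤ π.σ)
    (hL : 0 < π.L) (hμ : 0 < π.μ) (hV : 0 < π.V) (hR₀ : 0 < π.R₀)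
    (hkappa : 1 < π.p → 0 < π.δ → 1 / 2 ≤ π.kappa ^ (1 / π.p)) (k : ℕ) :
    π.beta k π.innerSteps * (π.V ^ 2 / 2)
      + ∑ l ∈ Finset.range (π.innerSteps + 1), bSeq π.p l * (π.δ + π.σ ^ 2 / π.batchSize k
        / (2 * ((π.radius k ^ 2)⁻¹ * π.beta k (l - 1) - π.L)))
      ≤ (∑ l ∈ Finset.range (π.innerSteps + 1), alphaSeq π.p l)
        * (π.μ / 2 * π.radiusSq (k + 1)) := by
  have hN := innerSteps_pos hL hμ hV
  have hN' : (0 : ℝ) < π.innerSteps := by exact_mod_cast hN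
  have hm : (0 : ℝ) < π.batchSize k := by exact_mod_cast batchSize_pos π k
  have hR : 0 < π.radius k := Real.sqrt_pos.2 (radiusSq_pos hδ hL hμ hV hR₀ k)
  have hsq := radius_sq hδ hL hμ hV hR₀ k
  have hκ := kappa_pos hL hμ hV
  have hs2 : π.σ ^ 2 / π.batchSize k = (π.σ / √(π.batchSize k)) ^ 2 := by
    rw [div_pow, Real.sq_sqrt hm.le]
  have hA : 0 ≤ ∑ l ∈ Finset.range (π.innerSteps + 1), alphaSeq π.p l :=
    Finset.sum_nonneg fun l _ => (alphaSeq_pos hp₁ l).le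
  rw [beta_eq, hs2]
  refine (error_le hp₁ hp₂ hL hR (by positivity) hV hN).trans ?_
  have h1 : C₁ * π.L * π.radius k ^ 2 * π.V ^ 2 / (π.innerSteps : ℝ) ^ π.p
      ≤ π.μ / (4 * Real.exp 1) * π.radiusSq k := by
    -- Rounding `κ^(1/p)` up gives `N_k^p ≥ κ`, and `κ` is chosen so that `C₁ L V² / κ = μ / (4e)`.
    have h2 : π.kappa ≤ (π.innerSteps : ℝ) ^ π.p := by
      calc π.kappa = (π.kappa ^ (1 / π.p)) ^ π.p := by
            rw [← Real.rpow_mul hκ.le, one_div, inv_mul_cancel₀ (by linarith), Real.rpow_one]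
        _ ≤ _ := Real.rpow_le_rpow (by positivity) (Nat.le_ceil _) (by linarith)
    rw [div_le_iff₀ (by positivity), hsq]
    have hr := radiusSq_pos hδ hL hμ hV hR₀ k
    refine le_trans (le_of_eq ?_) (mul_le_mul_of_nonneg_left h2 (by positivity))
    unfold kappa
    field_simp
  have h3 := noise_le hδ hL hμ hV hR₀ k
  have h4 : π.δ * ∑ l ∈ Finset.range (π.innerSteps + 1), bSeq π.p l
      ≤ (∑ l ∈ Finset.range (π.innerSteps + 1), alphaSeq π.p l)
        * ((2 : ℝ) ^ π.p / 2 * C₃ * π.kappa ^ ((π.p - 1) / π.p) * π.δ) := by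
    rcases hδ.eq_or_lt with h0 | hδ'
    · simp [← h0]
    · have h5 := mul_le_mul_of_nonneg_left
        (sum_bSeq_le hp₁ hp₂ hκ fun h => hkappa h hδ') hδ
      refine h5.trans ?_
      have h6 : (6 : ℝ) ≤ (2 : ℝ) ^ π.p / 2 * C₃ := by
        have : (1 : ℝ) ≤ (2 : ℝ) ^ π.p := Real.one_le_rpow (by norm_num) (by linarith)
        unfold C₃
        linarith
      have h7 := mul_le_mul_of_nonneg_right h6
        (show 0 ≤ π.kappa ^ ((π.p - 1) / π.p) * π.δ
          * ∑ l ∈ Finset.range (π.innerSteps + 1), alphaSeq π.p l by positivity)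
      refine le_trans (le_of_eq ?_) (h7.trans (le_of_eq ?_))
      · unfold innerSteps; ring
      · ring
  have h8 := mul_le_mul_of_nonneg_left (add_le_add h1 h3) hA
  rw [radiusSq_succ hμ]
  refine (add_le_add h8 h4).trans (le_of_eq ?_)
  have he := Real.exp_pos 1
  field_simp
  ring

theorem batchSize_le (hL : 0 < π.L) (hμ : 0 < π.μ) (hV : 0 < π.V) (hR₀ : 0 < π.R₀) (k : ℕ) :
    (π.batchSize k : ℝ) ≤ 1 + 16 * Real.exp (k + 2) * C₂ ^ 2 * π.σ ^ 2 * π.V ^ 2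
      / (π.μ ^ 2 * π.R₀ ^ 2) / π.innerSteps := by
  have hN : (0 : ℝ) < π.innerSteps := by exact_mod_cast innerSteps_pos hL hμ hV
  have h0 : 0 ≤ 16 * Real.exp (k + 2) * C₂ ^ 2 * π.σ ^ 2 * π.V ^ 2
      / (π.μ ^ 2 * π.R₀ ^ 2 * π.innerSteps) := by positivity
  have h1 := (Nat.ceil_lt_add_one h0).le
  unfold batchSize
  rw [Nat.cast_max, Nat.cast_one, div_div]
  exact max_le (by linarith) (by linarith)

/-- The total size of the mini-batches, when each of them is drawn `c` times in an outer
iteration. -/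
theorem sum_batchSize_le (hL : 0 < π.L) (hμ : 0 < π.μ) (hV : 0 < π.V) (hR₀ : 0 < π.R₀)
    {ε : ℝ} (hε : 0 < ε) (hε' : ε < π.μ * π.R₀ ^ 2) {K : ℕ}
    (hK : K = ⌈Real.log (π.μ * π.R₀ ^ 2 / ε)⌉₊) {c t : ℝ} (hc : 0 ≤ c)
    (hct : c ≤ t * π.innerSteps) :
    ∑ k ∈ Finset.range K, c * (π.batchSize k : ℝ)
      ≤ c * (1 + Real.log (π.μ * π.R₀ ^ 2 / ε))
        + t * (16 * Real.exp 3 * C₂ ^ 2 * π.σ ^ 2 * π.V ^ 2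
          / (π.μ * ε * (Real.exp 1 - 1))) := by
  have hN : (0 : ℝ) < π.innerSteps := by exact_mod_cast innerSteps_pos hL hμ hV
  have ht : 0 ≤ t := by
    by_contra! h
    nlinarith
  have he1 := exp_sub_one_pos
  have hlog : 0 ≤ Real.log (π.μ * π.R₀ ^ 2 / ε) :=
    Real.log_nonneg (by rw [le_div_iff₀ hε]; linarith)
  have hKle : (K : ℝ) ≤ 1 + Real.log (π.μ * π.R₀ ^ 2 / ε) := by
    rw [hK]
    linarith [Nat.ceil_lt_add_one hlog]
  set Y := 16 * C₂ ^ 2 * π.σ ^ 2 * π.V ^ 2 / (π.μ ^ 2 * π.R₀ ^ 2) with hY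
  have hY0 : 0 ≤ Y := by positivity
  -- The factor `N_k` in the denominator of the batch size cancels against `c ≤ t N_k`; what is left
  -- is geometric in `k` with ratio `e`.
  have hterm : ∀ k ∈ Finset.range K, c * (π.batchSize k : ℝ)
      ≤ c + t * Y * Real.exp 2 * Real.exp 1 ^ k := by
    intro k _
    have h1 := mul_le_mul_of_nonneg_left (batchSize_le hL hμ hV hR₀ k) hc
    refine h1.trans ?_
    have e1 : Real.exp (k + 2) = Real.exp 2 * Real.exp 1 ^ k := by
      rw [← Real.exp_nat_mul, ← Real.exp_add]; congr 1; ring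
    have e2 : c * (1 + 16 * Real.exp (k + 2) * C₂ ^ 2 * π.σ ^ 2 * π.V ^ 2
        / (π.μ ^ 2 * π.R₀ ^ 2) / π.innerSteps)
        = c + c / π.innerSteps * (Y * Real.exp 2 * Real.exp 1 ^ k) := by
      rw [e1, hY]; field_simp
    rw [e2]
    have h2 : c / π.innerSteps ≤ t := by rwa [div_le_iff₀ hN]
    have h3 := mul_le_mul_of_nonneg_right h2
      (show 0 ≤ Y * Real.exp 2 * Real.exp 1 ^ k by positivity)
    linarith
  refine (Finset.sum_le_sum hterm).trans ?_
  rw [Finset.sum_add_distrib, Finset.sum_const, Finset.card_range, nsmul_eq_mul,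
    ← Finset.mul_sum, geom_sum_eq (by linarith)]
  -- Rounding `K` up costs one factor `e`; with the `e²` from the batch size this makes `e³`.
  have hexp : Real.exp 1 ^ K ≤ Real.exp 1 * (π.μ * π.R₀ ^ 2 / ε) := by
    have hpos : 0 < π.μ * π.R₀ ^ 2 / ε := by positivity
    calc Real.exp 1 ^ K = Real.exp K := by rw [← Real.exp_nat_mul, mul_one]
      _ ≤ Real.exp (1 + Real.log (π.μ * π.R₀ ^ 2 / ε)) := Real.exp_le_exp.2 hKle
      _ = _ := by rw [Real.exp_add, Real.exp_log hpos]
  have h4 : t * Y * Real.exp 2 * ((Real.exp 1 ^ K - 1) / (Real.exp 1 - 1))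
      ≤ t * Y * Real.exp 2 * (Real.exp 1 * (π.μ * π.R₀ ^ 2 / ε) / (Real.exp 1 - 1)) := by
    have : Real.exp 1 ^ K - 1 ≤ Real.exp 1 * (π.μ * π.R₀ ^ 2 / ε) := by linarith
    gcongr
  have e3 : Real.exp 3 = Real.exp 2 * Real.exp 1 := by rw [← Real.exp_add]; norm_num
  have e4 : t * Y * Real.exp 2 * (Real.exp 1 * (π.μ * π.R₀ ^ 2 / ε) / (Real.exp 1 - 1))
      = t * (16 * Real.exp 3 * C₂ ^ 2 * π.σ ^ 2 * π.V ^ 2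
          / (π.μ * ε * (Real.exp 1 - 1))) := by
    rw [e3, hY]
    field_simp
  have h5 := mul_le_mul_of_nonneg_left hKle hc
  linarith

theorem innerSteps_le (hL : 0 < π.L) (hμ : 0 < π.μ) (hV : 0 < π.V) :
    (π.innerSteps : ℝ) ≤ 1 + π.kappa ^ (1 / π.p) := by
  have := Nat.ceil_lt_add_one (Real.rpow_pos_of_pos (kappa_pos hL hμ hV) (1 / π.p)).le
  unfold innerSteps
  linarith

/-- The radius after sufficiently many outer iterations. -/
theorem radiusSq_le_of_ceil (hL : 0 < π.L) (hμ : 0 < π.μ) (hV : 0 < π.V)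
    (hR₀ : 0 < π.R₀) {ε : ℝ} (hε : 0 < ε)
    (hδ : π.δ ≤ ε * (Real.exp 1 - 1) / ((2 : ℝ) ^ π.p * C₃ * Real.exp 1)
      * π.kappa ^ ((1 - π.p) / π.p)) {K : ℕ}
    (hK : K = ⌈Real.log (π.μ * π.R₀ ^ 2 / ε)⌉₊) :
    π.μ * π.R₀ ^ 2 / 2 * Real.exp (-K)
      + C₃ * Real.exp 1 * (2 : ℝ) ^ (π.p - 1) / (Real.exp 1 - 1)
        * π.kappa ^ ((π.p - 1) / π.p) * π.δ ≤ ε := by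
  have he1 := exp_sub_one_pos
  have hκ := kappa_pos hL hμ hV
  have h1 : π.μ * π.R₀ ^ 2 / 2 * Real.exp (-K) ≤ ε / 2 := by
    have hpos : 0 < π.μ * π.R₀ ^ 2 / ε := by positivity
    have h2 : Real.exp (-(K : ℝ)) ≤ (π.μ * π.R₀ ^ 2 / ε)⁻¹ := by
      rw [Real.exp_neg, inv_le_inv₀ (Real.exp_pos _) hpos, hK]
      calc π.μ * π.R₀ ^ 2 / ε = Real.exp (Real.log (π.μ * π.R₀ ^ 2 / ε)) :=
            (Real.exp_log hpos).symm
        _ ≤ _ := Real.exp_le_exp.2 (Nat.le_ceil _)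
    refine (mul_le_mul_of_nonneg_left h2 (by positivity)).trans (le_of_eq ?_)
    field_simp
  have h3 : C₃ * Real.exp 1 * (2 : ℝ) ^ (π.p - 1) / (Real.exp 1 - 1)
        * π.kappa ^ ((π.p - 1) / π.p) * π.δ ≤ ε / 2 := by
    have hC : 0 < C₃ := by unfold C₃; norm_num
    refine (mul_le_mul_of_nonneg_left hδ (by positivity)).trans (le_of_eq ?_)
    have e1 : π.kappa ^ ((π.p - 1) / π.p) * π.kappa ^ ((1 - π.p) / π.p) = 1 := by
      rw [← Real.rpow_add hκ]
      have : (π.p - 1) / π.p + (1 - π.p) / π.p = 0 := by ring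
      rw [this, Real.rpow_zero]
    have e2 : (2 : ℝ) ^ (π.p - 1) = (2 : ℝ) ^ π.p / 2 := Real.rpow_sub_one two_ne_zero _
    calc _ = (C₃ * Real.exp 1 * (2 : ℝ) ^ (π.p - 1) / (Real.exp 1 - 1))
          * (ε * (Real.exp 1 - 1) / ((2 : ℝ) ^ π.p * C₃ * Real.exp 1))
          * (π.kappa ^ ((π.p - 1) / π.p) * π.kappa ^ ((1 - π.p) / π.p)) := by ring
      _ = ε / 2 := by
          rw [e1, e2]
          field_simp
  linarith

end Params

end Rates

/-! ### Induction over the outer iterations -/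

section Restarts

variable {E : Type*} [NormedAddCommGroup E] [InnerProductSpace ℝ E]
  {Ω Ξ : Type*} [MeasurableSpace Ξ]

theorem history_le {mΩ : MeasurableSpace Ω} {π : Params} {ξ : ℕ → ℕ → ℕ → Ω → Ξ} (hξ : ∀ k i j, Measurable (ξ k i j))
    (k i : ℕ) : history π ξ k i ≤ mΩ :=
  iSup_le fun _ => iSup_le fun _ => iSup_le fun _ => iSup_le fun _ => (hξ _ _ _).comap_le

theorem measurable_sample_history {π : Params} {ξ : ℕ → ℕ → ℕ → Ω → Ξ} {k i k' i' j : ℕ}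
    (hi : k' < k ∧ i' ≤ π.innerSteps ∨ k' = k ∧ i' < i) (hj : j < π.batchSize k') :
    Measurable[history π ξ k i] (ξ k' i' j) := by
  have h1 : MeasurableSpace.comap (ξ k' i' j) inferInstance ≤ history π ξ k i :=
    le_iSup_of_le k' (le_iSup_of_le i' (le_iSup_of_le j (le_iSup_of_le ⟨hi, hj⟩ le_rfl)))
  exact (comap_measurable (ξ k' i' j)).mono h1 le_rfl

theorem history_le_history {π : Params} {ξ : ℕ → ℕ → ℕ → Ω → Ξ} {k i k' i' : ℕ}
    (H : ∀ a b : ℕ, a < k ∧ b ≤ π.innerSteps ∨ a = k ∧ b < i →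
      a < k' ∧ b ≤ π.innerSteps ∨ a = k' ∧ b < i') :
    history π ξ k i ≤ history π ξ k' i' :=
  iSup_le fun a => iSup_le fun b => iSup_le fun j => iSup_le fun hj =>
    le_iSup_of_le a (le_iSup_of_le b (le_iSup_of_le j (le_iSup_of_le ⟨H a b hj.1, hj.2⟩ le_rfl)))

/-- At a minimizer the zero functional is a subgradient, so the linear term disappears. -/
theorem IsStronglyConvex.norm_sq_le {Q : Set E} {μ : ℝ} {φ : E → ℝ}
    (hφ : IsStronglyConvex Q μ φ) {xs : E} (hxs : IsArgmin φ Q xs) {v : E} (hv : v ∈ Q) :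
    μ / 2 * ‖v - xs‖ ^ 2 ≤ φ v - φ xs := by
  have h1 := hφ xs hxs.1 0 (fun y hy => by simpa using hxs.2 hy) v hv
  rw [norm_sub_rev]
  simpa using h1

/-- The invariant of the restarted method. -/
theorem IsSIGMARun.invariant [FiniteDimensional ℝ E] [MeasurableSpace E] [BorelSpace E]
    {mΩ : MeasurableSpace Ω} {P : Measure Ω} [IsProbabilityMeasure P]
    {Q : Set E} (hQ : IsClosed Q) {f h : E → ℝ} (hf : ConvexOn ℝ Q f) (hh : ConvexOn ℝ Q h)
    (hφm : Measurable fun x : Q => f x + h x) {xs : E} (hxs : IsArgmin (fun x => f x + h x) Q xs)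
    {π : Params} (hp₁ : 1 ≤ π.p) (hp₂ : π.p ≤ 2) (hL : 0 < π.L) (hσ : 0 ≤ π.σ)
    (hμ : 0 < π.μ) (hV : 0 < π.V) (hR₀ : 0 < π.R₀) (hδ : 0 ≤ π.δ)
    (hkappa : 1 < π.p → 0 < π.δ → 1 / 2 ≤ π.kappa ^ (1 / π.p))
    (hφ : IsStronglyConvex Q π.μ fun x => f x + h x)
    {fδ : E → ℝ} {gδ : E → StrongDual ℝ E} {ν : Kernel E Ξ} [IsMarkovKernel ν]
    {F : E → Ξ → ℝ} {G : E → Ξ → StrongDual ℝ E}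
    (horacle : IsStochasticOracle Q f π.δ π.L π.σ fδ gδ ν F G)
    {d : E → ℝ} (hd : IsProxFunction d) (hdV : HasProxMomentBound d π.V)
    {u₀ : E} (hu₀ : ‖u₀ - xs‖ ≤ π.R₀) {K : ℕ}
    {ξ : ℕ → ℕ → ℕ → Ω → Ξ} {u : ℕ → Ω → E} {x y z xhat w : ℕ → ℕ → Ω → E}
    (hrun : IsSIGMARun Q h d π ν G u₀ K P ξ u x y z xhat w) :
    ∀ k ≤ K, Measurable[history π ξ k 0] (u k) ∧
      (Integrable (fun ω => ‖u k ω - xs‖ ^ 2) P ∧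
        ∫ ω, ‖u k ω - xs‖ ^ 2 ∂P ≤ π.radiusSq k) ∧
      -- The value at the starting point is not controlled, only its distance to `xs`; the restart
      -- needs only the distance.
      (1 ≤ k → Integrable (fun ω => f (u k ω) + h (u k ω)) P ∧
        ∫ ω, (f (u k ω) + h (u k ω)) ∂P - (f xs + h xs) ≤ π.μ / 2 * π.radiusSq k) := by
  intro k
  induction k with
  | zero =>
    intro _
    have h0 : u 0 = fun _ => u₀ := funext hrun.u_zero
    refine ⟨by rw [h0]; exact measurable_const, ⟨?_, ?_⟩, fun h1 => absurd h1 (by norm_num)⟩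
    · rw [h0]; exact integrable_const _
    · simp only [h0, Params.radiusSq_zero, integral_const, probReal_univ, one_smul]
      exact pow_le_pow_left₀ (norm_nonneg _) hu₀ 2
  | succ k ih =>
    intro hk
    have hk' : k < K := hk
    obtain ⟨hum, ⟨hui, hule⟩, -⟩ := ih hk'.le
    have hRpos : 0 < π.radius k :=
      Real.sqrt_pos.2 (Params.radiusSq_pos hδ hL hμ hV hR₀ k)
    have hRsq := Params.radius_sq hδ hL hμ hV hR₀ k
    have hm : (0 : ℝ) < π.batchSize k := by exact_mod_cast Params.batchSize_pos π k
    have hsm : 0 ≤ π.σ / √(π.batchSize k) := by positivity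
    have hc := isAdmissible_seq hp₁ hp₂ hL hRpos hsm hV
    rw [← Params.beta_eq] at hc
    have hβ : ∀ i, 0 < π.beta k i := by
      intro i
      rw [Params.beta_eq]
      unfold betaSeq
      positivity
    have hβσ : ∀ i, (π.radius k ^ 2)⁻¹ * π.beta k i - π.L = 0 → π.σ = 0 := by
      intro i hi
      rw [Params.beta_eq, betaSeq_sub hRpos] at hi
      have h1 := noiseCoeff_pos hp₁
      by_contra hne
      have h2 : 0 < π.σ := lt_of_le_of_ne hσ (Ne.symm hne)
      have h3 : 0 < noiseCoeff π.p * (π.σ / √(π.batchSize k)) / (π.radius k * π.V)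
        * ((i : ℝ) + π.p + 1) ^ ((2 * π.p - 1) / 2) := by positivity
      exact h3.ne' hi
    have hmono : Monotone fun i => history π ξ k i := fun i i' hii =>
      history_le_history fun a b hab => by omega
    obtain ⟨hym, hφi, hgap⟩ := expected_gap_le (P := P) hQ hf hh hφm hxs horacle hd hdV hRpos hc
      hβ hβσ hmono (fun i => history_le hrun.measurable_sample k i) (Params.batchSize_pos π k)
      hum hui (hule.trans hRsq.ge) (fun i j => hrun.measurable_sample k i j)
      (fun i _ j hj => measurable_sample_history (Or.inr ⟨rfl, Nat.lt_succ_self i⟩) hj)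
      (hrun.start k hk') (fun i hi => hrun.sample_law k hk' i hi)
      (fun ω => hrun.inner k hk' ω)
    have hu : u (k + 1) = fun ω => y k π.innerSteps ω := funext (hrun.u_succ k hk')
    have hA : 0 < ∑ l ∈ Finset.range (π.innerSteps + 1), alphaSeq π.p l :=
      Finset.sum_pos (fun l _ => alphaSeq_pos hp₁ l) ⟨0, by simp⟩
    have hbound : ∫ ω, (f (u (k + 1) ω) + h (u (k + 1) ω)) ∂P - (f xs + h xs)
        ≤ π.μ / 2 * π.radiusSq (k + 1) := by
      rw [hu]
      exact le_of_mul_le_mul_left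
        (hgap.trans (Params.inner_error_le hp₁ hp₂ hδ hσ hL hμ hV hR₀ hkappa k)) hA
    replace hφi : Integrable (fun ω => f (u (k + 1) ω) + h (u (k + 1) ω)) P := by rwa [hu]
    have hmeas : Measurable[history π ξ (k + 1) 0] (u (k + 1)) := by
      rw [hu]
      -- The history at `(k + 1, 0)` contains all queries with index up to `N_k`, hence the history
      -- at `(k, N_k + 1)`.
      exact hym.mono (history_le_history fun a b hab => by omega) le_rfl
    have huQ : ∀ ω, u (k + 1) ω ∈ Q := fun ω => by
      rw [hu]
      exact ((hrun.inner k hk' ω).mem hf.1 hc _ le_rfl).2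
    have hdist : ∀ ω, ‖u (k + 1) ω - xs‖ ^ 2
        ≤ 2 / π.μ * (f (u (k + 1) ω) + h (u (k + 1) ω) - (f xs + h xs)) := by
      intro ω
      have := hφ.norm_sq_le hxs (huQ ω)
      rw [div_mul_eq_mul_div, le_div_iff₀ hμ]
      linarith
    have := secondCountable_space (E := E)
    have hdi : Integrable (fun ω => 2 / π.μ
        * (f (u (k + 1) ω) + h (u (k + 1) ω) - (f xs + h xs))) P :=
      (hφi.sub (integrable_const _)).const_mul _
    have hni : Integrable (fun ω => ‖u (k + 1) ω - xs‖ ^ 2) P := by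
      refine hdi.mono' ?_ (Filter.Eventually.of_forall fun ω => ?_)
      · exact (((hmeas.mono (history_le hrun.measurable_sample _ _) le_rfl).sub_const
          xs).norm.pow_const 2).aestronglyMeasurable
      · rw [Real.norm_of_nonneg (by positivity)]
        exact hdist ω
    refine ⟨hmeas, ⟨hni, ?_⟩, fun _ => ⟨hφi, hbound⟩⟩
    refine (integral_mono hni hdi hdist).trans ?_
    rw [integral_const_mul, integral_sub hφi (integrable_const _)]
    simp only [integral_const, probReal_univ, one_smul]
    refine (mul_le_mul_of_nonneg_left hbound (by positivity)).trans (le_of_eq ?_)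
    field_simp

end Restarts

end SIGMA

end

/-! ### The main theorem -/

open SIGMA in
theorem theorem6 {E : Type*} [NormedAddCommGroup E] [InnerProductSpace ℝ E]
    [FiniteDimensional ℝ E] [MeasurableSpace E] [BorelSpace E]
    {Ξ : Type*} [MeasurableSpace Ξ]
    {Ω : Type*} [MeasurableSpace Ω] (P : Measure Ω) [IsProbabilityMeasure P]
    -- the problem
    (Q : Set E) (hQ_closed : IsClosed Q) (hQ_convex : Convex ℝ Q)
    (f h : E → ℝ) (hf : ConvexOn ℝ Q f) (hh : ConvexOn ℝ Q h)
    (hφ_meas : Measurable fun x : Q => f x + h x)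
    (xstar : E) (hxstar : IsArgmin (fun x => f x + h x) Q xstar)
    -- the parameters
    (π : Params) (hp₁ : 1 ≤ π.p) (hp₂ : π.p ≤ 2) (hL : 0 < π.L) (hσ : 0 ≤ π.σ)
    (hμ : 0 < π.μ) (hV : 0 < π.V) (hR₀ : 0 < π.R₀)
    (hkappa : 1 < π.p → 0 < π.δ → 1 / 2 ≤ π.kappa ^ (1 / π.p))
    (hφ : IsStronglyConvex Q π.μ fun x => f x + h x)
    -- the oracle
    (fδ : E → ℝ) (gδ : E → StrongDual ℝ E) (ν : Kernel E Ξ) [IsMarkovKernel ν]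
    (F : E → Ξ → ℝ) (G : E → Ξ → StrongDual ℝ E)
    (horacle : IsStochasticOracle Q f π.δ π.L π.σ fδ gδ ν F G)
    -- the prox-function
    (d : E → ℝ) (hd : IsProxFunction d) (hdV : HasProxMomentBound d π.V)
    -- the method
    (u₀ : E) (hu₀ : ‖u₀ - xstar‖ ≤ π.R₀) (K : ℕ)
    (ξ : ℕ → ℕ → ℕ → Ω → Ξ) (u : ℕ → Ω → E) (x y z xhat w : ℕ → ℕ → Ω → E)
    (hrun : IsSIGMARun Q h d π ν G u₀ K P ξ u x y z xhat w) :
    -- the rate of convergence after `K ≥ 1` outer iterations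
    (1 ≤ K →
      (Integrable (fun ω => f (u K ω) + h (u K ω)) P ∧
        ∫ ω, (f (u K ω) + h (u K ω)) ∂P - (f xstar + h xstar) ≤
          π.μ * π.R₀ ^ 2 / 2 * Real.exp (-K)
            + C₃ * Real.exp 1 * (2 : ℝ) ^ (π.p - 1) / (Real.exp 1 - 1)
              * π.kappa ^ ((π.p - 1) / π.p) * π.δ) ∧
      (Integrable (fun ω => ‖u K ω - xstar‖ ^ 2) P ∧
        ∫ ω, ‖u K ω - xstar‖ ^ 2 ∂P ≤
          π.R₀ ^ 2 * Real.exp (-K)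
            + C₃ * Real.exp 1 * (2 : ℝ) ^ π.p / (π.μ * (Real.exp 1 - 1))
              * π.kappa ^ ((π.p - 1) / π.p) * π.δ)) ∧
    -- the complexity
    (∀ ε : ℝ, 0 < ε → ε < π.μ * π.R₀ ^ 2 →
      π.δ ≤ ε * (Real.exp 1 - 1) / ((2 : ℝ) ^ π.p * C₃ * Real.exp 1)
        * π.kappa ^ ((1 - π.p) / π.p) →
      K = ⌈Real.log (π.μ * π.R₀ ^ 2 / ε)⌉₊ →
      (Integrable (fun ω => f (u K ω) + h (u K ω)) P ∧
        ∫ ω, (f (u K ω) + h (u K ω)) ∂P - (f xstar + h xstar) ≤ ε) ∧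
      (π.innerCalls K : ℝ) ≤
        (1 + π.kappa ^ (1 / π.p)) * (1 + Real.log (π.μ * π.R₀ ^ 2 / ε))
          + 16 * Real.exp 3 * C₂ ^ 2 * π.σ ^ 2 * π.V ^ 2 / (π.μ * ε * (Real.exp 1 - 1)) ∧
      (π.totalCalls K : ℝ) ≤
        (2 + π.kappa ^ (1 / π.p)) * (1 + Real.log (π.μ * π.R₀ ^ 2 / ε))
          + 2 * (16 * Real.exp 3 * C₂ ^ 2 * π.σ ^ 2 * π.V ^ 2
              / (π.μ * ε * (Real.exp 1 - 1)))) := by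
  -- The two oracle inequalities with both points equal to `xstar` enclose one number between `0`
  -- and `δ`.
  have hδ : 0 ≤ π.δ := by
    have h1 := horacle.inexact xstar hxstar.1 xstar hxstar.1
    have h2 := h1.1.trans h1.2
    simpa using h2
  have he1 := Params.exp_sub_one_pos
  have hκ := Params.kappa_pos hL hμ hV
  have hinv := hrun.invariant hQ_closed hf hh hφ_meas hxstar hp₁ hp₂ hL hσ hμ hV hR₀ hδ hkappa hφ
    horacle hd hdV hu₀ K le_rfl
  have hC : 0 < C₃ := by unfold C₃; norm_num
  have hrad : π.radiusSq K ≤ π.R₀ ^ 2 * Real.exp (-K)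
      + C₃ * Real.exp 1 * (2 : ℝ) ^ π.p / (π.μ * (Real.exp 1 - 1))
        * π.kappa ^ ((π.p - 1) / π.p) * π.δ := by
    have h0 : 0 ≤ C₃ * Real.exp 1 * (2 : ℝ) ^ π.p / (π.μ * (Real.exp 1 - 1))
        * π.kappa ^ ((π.p - 1) / π.p) * π.δ := by positivity
    have h1 := mul_nonneg h0 (Real.exp_pos (-(K : ℝ))).le
    have e1 : π.radiusSq K = π.R₀ ^ 2 * Real.exp (-K)
      + C₃ * Real.exp 1 * (2 : ℝ) ^ π.p / (π.μ * (Real.exp 1 - 1))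
        * π.kappa ^ ((π.p - 1) / π.p) * π.δ * (1 - Real.exp (-K)) := by
      unfold Params.radiusSq
      ring
    rw [e1]
    linarith
  have hrate : 1 ≤ K → Integrable (fun ω => f (u K ω) + h (u K ω)) P ∧
      ∫ ω, (f (u K ω) + h (u K ω)) ∂P - (f xstar + h xstar) ≤
        π.μ * π.R₀ ^ 2 / 2 * Real.exp (-K)
          + C₃ * Real.exp 1 * (2 : ℝ) ^ (π.p - 1) / (Real.exp 1 - 1)
            * π.kappa ^ ((π.p - 1) / π.p) * π.δ := by
    intro hK
    obtain ⟨h1, h2⟩ := hinv.2.2 hK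
    refine ⟨h1, h2.trans ?_⟩
    refine (mul_le_mul_of_nonneg_left hrad (by positivity)).trans (le_of_eq ?_)
    rw [Real.rpow_sub_one two_ne_zero]
    field_simp
  refine ⟨fun hK => ⟨hrate hK, hinv.2.1.1, hinv.2.1.2.trans hrad⟩, ?_⟩
  intro ε hε hε' hδε hK
  -- The strict bound on `ε` ensures at least one outer iteration, without which the gap is not
  -- controlled.
  have hlog : 0 < Real.log (π.μ * π.R₀ ^ 2 / ε) :=
    Real.log_pos (by rw [lt_div_iff₀ hε]; linarith)
  have hK1 : 1 ≤ K := by rw [hK]; exact Nat.ceil_pos.2 hlog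
  have hN := Params.innerSteps_pos hL hμ hV
  have hN1 : (1 : ℝ) ≤ π.innerSteps := by exact_mod_cast hN
  have hNle := Params.innerSteps_le hL hμ hV
  obtain ⟨h1, h2⟩ := hrate hK1
  refine ⟨⟨h1, h2.trans (Params.radiusSq_le_of_ceil hL hμ hV hR₀ hε hδε hK)⟩, ?_, ?_⟩
  · have h3 := Params.sum_batchSize_le hL hμ hV hR₀ hε hε' hK
      (c := π.innerSteps) (t := 1) (by positivity) (by linarith)
    have e1 : (π.innerCalls K : ℝ)
        = ∑ k ∈ Finset.range K, (π.innerSteps : ℝ) * (π.batchSize k : ℝ) := by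
      simp [Params.innerCalls]
    rw [e1]
    have h4 := mul_le_mul_of_nonneg_right hNle
      (show 0 ≤ 1 + Real.log (π.μ * π.R₀ ^ 2 / ε) by linarith)
    linarith
  -- Including the starting point, `N_k + 1 ≤ 2 N_k` batches are drawn, whence the factor `2` in the
  -- noise term.
  · have h3 := Params.sum_batchSize_le hL hμ hV hR₀ hε hε' hK
      (c := π.innerSteps + 1) (t := 2) (by positivity) (by linarith)
    have e1 : (π.totalCalls K : ℝ)
        = ∑ k ∈ Finset.range K, ((π.innerSteps : ℝ) + 1) * (π.batchSize k : ℝ) := by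
      simp [Params.totalCalls]
    rw [e1]
    have h4 := mul_le_mul_of_nonneg_right (show (π.innerSteps : ℝ) + 1 ≤ 2 + π.kappa ^ (1 / π.p) by
      linarith) (show 0 ≤ 1 + Real.log (π.μ * π.R₀ ^ 2 / ε) by linarith)
    linarith
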